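/- **Proposition 3.5.** Let $\Sigma$ be a smooth compact manifold without boundary, of any dimension $n$ (in particular $n=3$). Let $\beta^*\ge 0$, and let $\beta\mapsto g_{ab}(\beta)$, $\beta\in[0,\beta^*]$, be a Ricci flow on $\Sigma$, that is, a family of Riemannian metrics, smooth on $[0,\beta^*]\times\Sigma$, with $\partial_\beta g_{ab}=-2R_{ab}$. For symmetric 2-tensors put $$\Delta_L h_{ab}=g^{kl}\nabla_k\nabla_l h_{ab}-R_{as}h^{s}_{b}-R_{bs}h^{s}_{a}+2R_{asbt}h^{st},\qquad \Delta_L H^{ab}=g^{kl}\nabla_k\nabla_l H^{ab}-R^{a}{}_{s}H^{sb}-R^{b}{}_{s}H^{as}+2R^{a}{}_{s}{}^{b}{}_{t}H^{st},$$ where the Riemann tensor is normalized so that $R_{ab}=g^{st}R_{asbt}$ is the Ricci tensor, positive on round spheres; let $R=g^{ab}R_{ab}$ be the scalar curvature and $d\mu_g$ the Riemannian measure. Let $\beta\mapsto\widetilde h_{ab}(\beta)$, $\beta\in[0,\beta^*]$, be a family of symmetric tensor fields, smooth on $[0,\beta^*]\times\Sigma$, that solves the reduced linearized Ricci flow $$\partial_\beta\widetilde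 h_{ab}=\Delta_L\widetilde h_{ab}$$ along $g(\beta)$. With $\eta=\beta^*-\beta$, write $g(\eta):=g(\beta^*-\eta)$ (the backward Ricci flow) and $\widetilde h_{ab}(\eta):=\widetilde h_{ab}(\beta^*-\eta)$. Let $\eta\mapsto H^{ab}(\eta)$, $\eta\in[0,\beta^*]$, be a family of symmetric tensor fields, smooth on $[0,\beta^*]\times\Sigma$, that solves the conjugate linearized Ricci flow $$\partial_\eta H^{ab}=\Delta_L H^{ab}-R\,H^{ab}$$ along the backward Ricci flow $g(\eta)$, with arbitrary initial datum $H^{ab}(\eta=0)=H^{ab}_*$. Then for every $\eta\in[0,\beta^*]$ (with one-sided derivatives at the end points) $$\frac{d}{d\eta}\int_\Sigma H^{ab}(\eta)\,\widetilde h_{ab}(\eta)\,d\mu_{g(\eta)}=0 ,$$ and in particular $$\int_\Sigma H^{ab}\,\widetilde h_{ab}\,d\mu_{g}\Big|_{\eta=0}=\int_\Sigma H^{ab}\,\widetilde h_{ab}\,d\mu_{g}\Big|_{\eta=\beta^*}.$$ -/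

import Mathlib

open Set MeasureTheory Bundle
open scoped Manifold ContDiff Matrix

noncomputable section

namespace ConjRicci

/-! ### Tensor calculus in local coordinates

All objects below are functions of a coordinate point `y` in an open subset of `ℝⁿ`.
`G y a b` stands for the components `g_{ab}(y)` of a Riemannian metric; the indices of every
array are listed in the order in which they are written on paper. -/

/-- The coordinate space `ℝⁿ`. -/
abbrev Coord (n : ℕ) : Type := EuclideanSpace ℝ (Fin n)

/-- Two-index arrays `T_{ab}(y)` (or `T^{ab}(y)`) of functions of the coordinates. -/
abbrev Comp2 (n : ℕ) : Type := Coord n → Matrix (Fin n) (Fin n) ℝ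

variable {n : ℕ}

/-- The coordinate partial derivative `∂_i f`. -/
def pd (i : Fin n) (f : Coord n → ℝ) (y : Coord n) : ℝ :=
  fderiv ℝ f y (EuclideanSpace.single i 1)

/-- The components `g^{ab}` of the inverse metric. -/
def ginv (G : Comp2 n) : Comp2 n := fun y => (G y)⁻¹

/-- The Christoffel symbols of the Levi-Civita connection,
`Γ^k_{ij} = ½ g^{kl} (∂_i g_{jl} + ∂_j g_{il} - ∂_l g_{ij})`. -/
def christoffel (G : Comp2 n) (y : Coord n) (k i j : Fin n) : ℝ :=
  (1 / 2) * ∑ l, ginv G y k l *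
    (pd i (fun z => G z j l) y + pd j (fun z => G z i l) y - pd l (fun z => G z i j) y)

/-- The component along `∂_l` of `R(∂_i, ∂_j) ∂_k = ∇_i ∇_j ∂_k - ∇_j ∇_i ∂_k`. -/
def curvEndo (G : Comp2 n) (y : Coord n) (i j k l : Fin n) : ℝ :=
  pd i (fun z => christoffel G z l j k) y - pd j (fun z => christoffel G z l i k) y
    + ∑ m, (christoffel G y m j k * christoffel G y l i m
      - christoffel G y m i k * christoffel G y l j m)

/-- The Riemann tensor `R_{asbt} = g(R(∂_a, ∂_s) ∂_t, ∂_b)`; with this convention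
`R_{asbt} = g_{ab} g_{st} - g_{at} g_{sb}` on the unit sphere. -/
def riemann (G : Comp2 n) (y : Coord n) (a s b t : Fin n) : ℝ :=
  ∑ l, curvEndo G y a s t l * G y l b

/-- The Ricci tensor `R_{ab} = g^{st} R_{asbt}`. -/
def ricci (G : Comp2 n) (y : Coord n) (a b : Fin n) : ℝ :=
  ∑ s, ∑ t, ginv G y s t * riemann G y a s b t

/-- The scalar curvature `R = g^{ab} R_{ab}`. -/
def scalarCurv (G : Comp2 n) (y : Coord n) : ℝ :=
  ∑ a, ∑ b, ginv G y a b * ricci G y a b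

/-- `∇_k h_{ab}`. -/
def covD (G h : Comp2 n) (y : Coord n) (k a b : Fin n) : ℝ :=
  pd k (fun z => h z a b) y
    - ∑ m, christoffel G y m k a * h y m b - ∑ m, christoffel G y m k b * h y a m

/-- `∇_l ∇_k h_{ab}`. -/
def covDD (G h : Comp2 n) (y : Coord n) (l k a b : Fin n) : ℝ :=
  pd l (fun z => covD G h z k a b) y
    - ∑ m, christoffel G y m l k * covD G h y m a b
    - ∑ m, christoffel G y m l a * covD G h y k m b
    - ∑ m, christoffel G y m l b * covD G h y k a m

/-- `∇_k H^{ab}`. -/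
def conD (G H : Comp2 n) (y : Coord n) (k a b : Fin n) : ℝ :=
  pd k (fun z => H z a b) y
    + ∑ m, christoffel G y a k m * H y m b + ∑ m, christoffel G y b k m * H y a m

/-- `∇_l ∇_k H^{ab}`. -/
def conDD (G H : Comp2 n) (y : Coord n) (l k a b : Fin n) : ℝ :=
  pd l (fun z => conD G H z k a b) y
    - ∑ m, christoffel G y m l k * conD G H y m a b
    + ∑ m, christoffel G y a l m * conD G H y k m b
    + ∑ m, christoffel G y b l m * conD G H y k a m

/-- The Lichnerowicz-de Rham Laplacian on covariant symmetric two-tensors,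
`Δ_L h_{ab} = g^{kl} ∇_k ∇_l h_{ab} - R_{as} h_b^s - R_{bs} h_a^s + 2 R_{asbt} h^{st}`. -/
def lichCov (G h : Comp2 n) (y : Coord n) (a b : Fin n) : ℝ :=
  ∑ k, ∑ l, ginv G y k l * covDD G h y k l a b
    - ∑ s, ∑ u, ricci G y a s * (ginv G y s u * h y b u)
    - ∑ s, ∑ u, ricci G y b s * (ginv G y s u * h y a u)
    + 2 * ∑ s, ∑ t, riemann G y a s b t *
        ∑ u, ∑ v, ginv G y s u * ginv G y t v * h y u v

/-- The Lichnerowicz-de Rham Laplacian on contravariant symmetric two-tensors,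
`Δ_L H^{ab} = g^{kl} ∇_k ∇_l H^{ab} - R^a_s H^{bs} - R^b_s H^{as} + 2 R^a_s^b_t H^{st}`. -/
def lichCon (G H : Comp2 n) (y : Coord n) (a b : Fin n) : ℝ :=
  ∑ k, ∑ l, ginv G y k l * conDD G H y k l a b
    - ∑ s, ∑ u, (ginv G y a u * ricci G y u s) * H y b s
    - ∑ s, ∑ u, (ginv G y b u * ricci G y u s) * H y a s
    + 2 * ∑ s, ∑ t, (∑ u, ∑ v, ginv G y a u * ginv G y b v * riemann G y u s v t) * H y s t

/-! ### Tensor fields on a manifold and their components -/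

variable {M : Type*} [TopologicalSpace M] [ChartedSpace (Coord n) M]

variable (n M) in
/-- Covariant two-tensor fields: a bilinear form on each tangent space. -/
abbrev CovTensor : Type _ :=
  ∀ x : M, TangentSpace (𝓡 n) x →L[ℝ] TangentSpace (𝓡 n) x →L[ℝ] ℝ

variable (n M) in
/-- Contravariant two-tensor fields: a bilinear form on each cotangent space. -/
abbrev ConTensor : Type _ :=
  ∀ x : M, (TangentSpace (𝓡 n) x →L[ℝ] ℝ) →L[ℝ] (TangentSpace (𝓡 n) x →L[ℝ] ℝ) →L[ℝ] ℝ

variable (n M) in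
/-- Smooth Riemannian metrics. -/
abbrev Metric [IsManifold (𝓡 n) ∞ M] : Type _ :=
  ContMDiffRiemannianMetric (𝓡 n) ∞ (Coord n) (fun x : M => TangentSpace (𝓡 n) x)

/-- The coordinate vector `∂_i` of the chart `φ`, at the point with coordinates `y`. -/
def frame (φ : OpenPartialHomeomorph M (Coord n)) (y : Coord n) (i : Fin n) :
    TangentSpace (𝓡 n) (φ.symm y) :=
  mfderiv (𝓡 n) (𝓡 n) φ.symm y (EuclideanSpace.single i (1 : ℝ) : Coord n)

/-- The coordinate covector `dx^i` of the chart `φ`, at the point with coordinates `y`. -/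
def coframe (φ : OpenPartialHomeomorph M (Coord n)) (y : Coord n) (i : Fin n) :
    TangentSpace (𝓡 n) (φ.symm y) →L[ℝ] ℝ :=
  (EuclideanSpace.proj i : Coord n →L[ℝ] ℝ).comp
    (mfderiv (𝓡 n) (𝓡 n) φ (φ.symm y) : TangentSpace (𝓡 n) (φ.symm y) →L[ℝ] Coord n)

/-- The components `h_{ab} = h(∂_a, ∂_b)` in the chart `φ`. -/
def covComp (φ : OpenPartialHomeomorph M (Coord n)) (h : CovTensor n M) : Comp2 n :=
  fun y a b => h (φ.symm y) (frame φ y a) (frame φ y b)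

/-- The components `H^{ab} = H(dx^a, dx^b)` in the chart `φ`. -/
def conComp (φ : OpenPartialHomeomorph M (Coord n)) (H : ConTensor n M) : Comp2 n :=
  fun y a b => H (φ.symm y) (coframe φ y a) (coframe φ y b)

/-- The full contraction `H^{ab} h_{ab}` at `x`, written in the preferred chart at `x` (the value
does not depend on the chart). -/
def pairing (H : ConTensor n M) (h : CovTensor n M) (x : M) : ℝ :=
  ∑ a, ∑ b, conComp (chartAt (Coord n) x) H (chartAt (Coord n) x x) a b *
    covComp (chartAt (Coord n) x) h (chartAt (Coord n) x x) a b

/-- A time-dependent covariant tensor field is smooth on `[0, T] × M`: its components in every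
chart are smooth functions of time and position. -/
def SmoothCovFamily (h : ℝ → CovTensor n M) (T : ℝ) : Prop :=
  ∀ φ ∈ atlas (Coord n) M, ∀ a b : Fin n,
    ContDiffOn ℝ ∞ (fun p : ℝ × Coord n => covComp φ (h p.1) p.2 a b) (Icc 0 T ×ˢ φ.target)

/-- A time-dependent contravariant tensor field is smooth on `[0, T] × M`. -/
def SmoothConFamily (H : ℝ → ConTensor n M) (T : ℝ) : Prop :=
  ∀ φ ∈ atlas (Coord n) M, ∀ a b : Fin n,
    ContDiffOn ℝ ∞ (fun p : ℝ × Coord n => conComp φ (H p.1) p.2 a b) (Icc 0 T ×ˢ φ.target)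

variable [IsManifold (𝓡 n) ∞ M]

/-- The components `g_{ab}` of a Riemannian metric in the chart `φ`. -/
def metComp (φ : OpenPartialHomeomorph M (Coord n)) (g : Metric n M) : Comp2 n :=
  covComp φ g.inner

/-! ### The Riemannian measure -/

section Volume

variable [T2Space M] [CompactSpace M]

variable (n M) in
/-- A smooth partition of unity `(ρ_p)_{p ∈ M}`, with `ρ_p` supported in the domain of the
preferred chart at `p`; by compactness only finitely many `ρ_p` are not identically zero. -/
def chartPartition : SmoothPartitionOfUnity M (𝓡 n) M univ :=
  (SmoothPartitionOfUnity.exists_isSubordinate_chartAt_source (𝓡 n) M).choose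

variable (n M) in
theorem chartPartition_isSubordinate :
    (chartPartition n M).IsSubordinate fun p => (chartAt (Coord n) p).source :=
  (SmoothPartitionOfUnity.exists_isSubordinate_chartAt_source (𝓡 n) M).choose_spec

variable [MeasurableSpace M]

/-- The measure `√(det g_{ab}) dy¹ ⋯ dyⁿ` of the chart `φ`, carried to the domain of `φ`. -/
def chartVolume (g : Metric n M) (φ : OpenPartialHomeomorph M (Coord n)) : Measure M :=
  Measure.map φ.symm ((volume.restrict φ.target).withDensity
    fun y => ENNReal.ofReal (Real.sqrt (metComp φ g y).det))

/-- The Riemannian measure `dμ_g = ∑_p ρ_p √(det g_{ab}) dy¹ ⋯ dyⁿ`, glued from the measures of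
the charts with a partition of unity (the result does not depend on the partition). -/
def riemannianMeasure (g : Metric n M) : Measure M :=
  Measure.sum fun p : M => (chartVolume g (chartAt (Coord n) p)).withDensity
    fun x => ENNReal.ofReal (chartPartition n M p x)

end Volume

/-! ### The flows -/

/-- `g` is a smooth Ricci flow on `[0, T]`: `∂g_{ab}/∂β = -2 R_{ab}` (in every chart, with
one-sided time derivatives at the ends of the interval). -/
structure IsRicciFlow (g : ℝ → Metric n M) (T : ℝ) : Prop where
  smooth : SmoothCovFamily (fun β => (g β).inner) T
  flow : ∀ φ ∈ atlas (Coord n) M, ∀ β ∈ Icc 0 T, ∀ y ∈ φ.target, ∀ a b : Fin n,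
    HasDerivWithinAt (fun τ => metComp φ (g τ) y a b)
      (-2 * ricci (metComp φ (g β)) y a b) (Icc 0 T) β

/-- `h` is a smooth symmetric solution on `[0, T]` of the reduced linearized Ricci flow
`∂h_{ab}/∂β = Δ_L h_{ab}` along `β ↦ g β`. -/
structure IsReducedLinearizedFlow (g : ℝ → Metric n M) (h : ℝ → CovTensor n M) (T : ℝ) :
    Prop where
  symm : ∀ β ∈ Icc 0 T, ∀ x v w, h β x v w = h β x w v
  smooth : SmoothCovFamily h T
  flow : ∀ φ ∈ atlas (Coord n) M, ∀ β ∈ Icc 0 T, ∀ y ∈ φ.target, ∀ a b : Fin n,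
    HasDerivWithinAt (fun τ => covComp φ (h τ) y a b)
      (lichCov (metComp φ (g β)) (covComp φ (h β)) y a b) (Icc 0 T) β

/-- `H` is a smooth symmetric solution on `[0, T]` of the conjugate linearized Ricci flow
`∂H^{ab}/∂η = Δ_L H^{ab} - R H^{ab}` along a family of metrics `η ↦ γ η` (in the intended use, a
backward Ricci flow). -/
structure IsConjugateLinearizedFlow (γ : ℝ → Metric n M) (H : ℝ → ConTensor n M) (T : ℝ) :
    Prop where
  symm : ∀ η ∈ Icc 0 T, ∀ x v w, H η x v w = H η x w v
  smooth : SmoothConFamily H T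
  flow : ∀ φ ∈ atlas (Coord n) M, ∀ η ∈ Icc 0 T, ∀ y ∈ φ.target, ∀ a b : Fin n,
    HasDerivWithinAt (fun τ => conComp φ (H τ) y a b)
      (lichCon (metComp φ (γ η)) (conComp φ (H η)) y a b
        - scalarCurv (metComp φ (γ η)) y * conComp φ (H η) y a b) (Icc 0 T) η

end ConjRicci

end

noncomputable section

namespace ConjRicci

open Filter Topology

/-! ### Local tensor calculus: Green's identity for the Lichnerowicz Laplacian and its behaviour
under coordinate changes. -/

section

variable {n : ℕ}

/-! ### Calculus of coordinate partial derivatives -/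

section PartialDerivative

variable {f g : Coord n → ℝ} {y : Coord n} {i : Fin n}

/-! Along the backward flow `∂_η g = 2 Ric`, so `∂_η √g = R √g`, which cancels the term `-R H` of
the conjugate equation. What remains of the derivative of `√g H^{ab} h_{ab}` is `√g (Δ_L H · h - H ·
Δ_L h)`, the minus sign coming from time reversal. The operator `Δ_L` is formally self-adjoint: the
second-order parts differ by the divergence of `S_l = ∇_l H · h - H · ∇_l h`, and the curvature
terms are adjoint to each other because the Ricci tensor is symmetric and `R_{asbt} = R_{satb}`. So
in every chart the density evolves by the exact divergence `∂_k (√g g^{kl} S_l)`; see `sum_pd_flux`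
and `hasDerivWithinAt_pairingDensity`.

This divergence integrates to zero over the closed manifold
(`sum_setIntegral_cutoff_mul_divergence`). Let `F` be the flux density and `ρ_p` the partition of
unity. Integrating by parts in the chart at `p` turns the integral into `-∑_p ∫ F(dρ_p)`. Inserting
`∑_q ρ_q = 1` and carrying each term to the chart at `q` lets the sum over `p` be taken inside one
chart, where `∑_p dρ_p = d1 = 0`. The one global fact needed is that `F(dρ_p)` transforms as a
density (`sum_flux_mul_pd_transform`), which rests on the transformation law of the Christoffel
symbols (`jac_mul_conn`).

The partition does not depend on time, so the time derivative passes under finitely many chart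
integrals over fixed compact sets (`hasDerivWithinAt_setIntegral`). The symmetry of the Ricci tensor
is read off the flow, where `-2 Ric` is the derivative of a symmetric matrix, so the first Bianchi
identity is not used. -/

theorem pd_add (hf : DifferentiableAt ℝ f y) (hg : DifferentiableAt ℝ g y) :
    pd i (fun z => f z + g z) y = pd i f y + pd i g y := by
  simp [pd, fderiv_fun_add hf hg]

theorem pd_sub (hf : DifferentiableAt ℝ f y) (hg : DifferentiableAt ℝ g y) :
    pd i (fun z => f z - g z) y = pd i f y - pd i g y := by
  simp [pd, fderiv_fun_sub hf hg]

theorem pd_mul (hf : DifferentiableAt ℝ f y) (hg : DifferentiableAt ℝ g y) :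
    pd i (fun z => f z * g z) y = pd i f y * g y + f y * pd i g y := by
  simp [pd, fderiv_fun_mul hf hg]; ring

theorem pd_sum {ι : Type*} {s : Finset ι} {F : ι → Coord n → ℝ}
    (hF : ∀ j ∈ s, DifferentiableAt ℝ (F j) y) :
    pd i (fun z => ∑ j ∈ s, F j z) y = ∑ j ∈ s, pd i (F j) y := by
  simp [pd, fderiv_fun_sum hF]

theorem pd_const (c : ℝ) : pd i (fun _ : Coord n => c) y = 0 := by
  simp [pd]

theorem pd_congr (h : f =ᶠ[𝓝 y] g) : pd i f y = pd i g y := by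
  simp [pd, h.fderiv_eq]

theorem contDiffAt_pd (hf : ContDiffAt ℝ ∞ f y) : ContDiffAt ℝ ∞ (pd i f) y :=
  (hf.fderiv_right (m := ∞) (by simp)).clm_apply contDiffAt_const

/-- Used for the antisymmetry of the curvature in its last index pair and for the symmetry of `∂_a
J^i_b` under coordinate changes. -/
theorem pd_comm (hf : ContDiffAt ℝ ∞ f y) (i j : Fin n) :
    pd i (pd j f) y = pd j (pd i f) y := by
  have hs : IsSymmSndFDerivAt ℝ f y := hf.isSymmSndFDerivAt (by simpa using WithTop.coe_le_coe.2 (le_top : (2 : ℕ∞) ≤ ⊤))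
  have hd : DifferentiableAt ℝ (fderiv ℝ f) y :=
    (hf.fderiv_right (m := ∞) (by simp)).differentiableAt (by simp)
  have key : ∀ k l : Fin n, pd k (pd l f) y =
      fderiv ℝ (fderiv ℝ f) y (EuclideanSpace.single k 1) (EuclideanSpace.single l 1) := by
    intro k l
    change fderiv ℝ (fun z => fderiv ℝ f z (EuclideanSpace.single l 1)) y _ = _
    rw [fderiv_clm_apply hd (differentiableAt_const _)]
    simp
  rw [key, key]
  exact hs.eq _ _

end PartialDerivative

/-! ### Matrix-valued functions of the coordinates -/

/-- The entrywise partial derivative `∂_i A`. -/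
def pdM (i : Fin n) (A : Comp2 n) (y : Coord n) : Matrix (Fin n) (Fin n) ℝ :=
  Matrix.of fun a b => pd i (fun z => A z a b) y

@[simp] theorem pdM_apply (i : Fin n) (A : Comp2 n) (y : Coord n) (a b : Fin n) :
    pdM i A y a b = pd i (fun z => A z a b) y := rfl

/-- All the entries of a matrix-valued function are smooth at a point. -/
def SmoothAt2 (A : Comp2 n) (y : Coord n) : Prop :=
  ∀ a b, ContDiffAt ℝ ∞ (fun z => A z a b) y

namespace SmoothAt2

variable {A B : Comp2 n} {y : Coord n}

theorem differentiableAt (hA : SmoothAt2 A y) (a b : Fin n) :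
    DifferentiableAt ℝ (fun z => A z a b) y := (hA a b).differentiableAt (by simp)

theorem mul (hA : SmoothAt2 A y) (hB : SmoothAt2 B y) : SmoothAt2 (fun z => A z * B z) y := by
  intro a b
  simp only [Matrix.mul_apply]
  exact ContDiffAt.sum fun j _ => (hA a j).mul (hB j b)

theorem transpose (hA : SmoothAt2 A y) : SmoothAt2 (fun z => (A z)ᵀ) y := fun a b => hA b a

theorem det (hA : SmoothAt2 A y) : ContDiffAt ℝ ∞ (fun z => (A z).det) y := by
  simp only [Matrix.det_apply']
  exact ContDiffAt.sum fun σ _ => contDiffAt_const.mul (contDiffAt_prod fun j _ => hA _ _)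

theorem adjugate (hA : SmoothAt2 A y) : SmoothAt2 (fun z => (A z).adjugate) y := by
  intro a b
  simp only [Matrix.adjugate_apply]
  refine det (A := fun z => (A z).updateRow b (Pi.single a 1)) fun c d => ?_
  by_cases hc : c = b
  · subst hc
    simpa using contDiffAt_const
  · simpa [Matrix.updateRow_ne hc] using hA c d

/-- By Cramer's rule the inverse is the adjugate over the determinant, both polynomial in the
entries. -/
theorem ginv (hA : SmoothAt2 A y) (hd : (A y).det ≠ 0) : SmoothAt2 (ginv A) y := by
  intro a b
  simp only [ConjRicci.ginv, Matrix.inv_def, Ring.inverse_eq_inv', Matrix.smul_apply, smul_eq_mul]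
  exact (hA.det.inv hd).mul (hA.adjugate a b)

theorem pdM (hA : SmoothAt2 A y) (i : Fin n) : SmoothAt2 (pdM i A) y := fun a b =>
  contDiffAt_pd (hA a b)

end SmoothAt2

section pdM

variable {A B : Comp2 n} {y : Coord n} {i : Fin n}

theorem pdM_mul (hA : SmoothAt2 A y) (hB : SmoothAt2 B y) :
    pdM i (fun z => A z * B z) y = pdM i A y * B y + A y * pdM i B y := by
  ext a b
  simp only [pdM_apply, Matrix.mul_apply, Matrix.add_apply]
  rw [pd_sum fun j _ => (hA.differentiableAt a j).fun_mul (hB.differentiableAt j b),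
    ← Finset.sum_add_distrib]
  exact Finset.sum_congr rfl fun j _ => pd_mul (hA.differentiableAt a j) (hB.differentiableAt j b)

theorem pdM_transpose : pdM i (fun z => (A z)ᵀ) y = (pdM i A y)ᵀ := rfl

theorem pdM_congr (h : ∀ᶠ z in 𝓝 y, A z = B z) : pdM i A y = pdM i B y := by
  ext a b
  exact pd_congr (h.mono fun z hz => by simp [hz])

/-- Differentiate `A⁻¹ A = 1`, which holds on a whole neighbourhood because the determinant stays
nonzero there. -/
theorem pdM_ginv (hA : SmoothAt2 A y) (hd : (A y).det ≠ 0) :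
    pdM i (ginv A) y = -(ginv A y * pdM i A y * ginv A y) := by
  have hinv : ∀ᶠ z in 𝓝 y, (fun z => ginv A z * A z) z = (fun _ => 1) z := by
    filter_upwards [hA.det.continuousAt.eventually_ne hd] with z hz
    exact Matrix.nonsing_inv_mul _ (isUnit_iff_ne_zero.mpr hz)
  have h0 : pdM i (fun _ : Coord n => (1 : Matrix (Fin n) (Fin n) ℝ)) y = 0 := by
    ext a b
    simp [pd_const]
  have h1 := pdM_congr (i := i) hinv
  rw [h0, pdM_mul (hA.ginv hd) hA] at h1
  have h2 : A y * ginv A y = 1 := Matrix.mul_nonsing_inv _ (isUnit_iff_ne_zero.mpr hd)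
  calc pdM i (ginv A) y = pdM i (ginv A) y * (A y * ginv A y) := by rw [h2, mul_one]
    _ = (pdM i (ginv A) y * A y) * ginv A y := by rw [mul_assoc]
    _ = _ := by rw [eq_neg_of_add_eq_zero_left h1, neg_mul]

end pdM

/-! ### Derivative of the determinant -/

/-- Laplace expansion along the replaced row: the cofactors of row `i` do not see row `i`, so they
are those of `M`. This is the algebraic half of Jacobi's formula. -/
theorem sum_det_updateRow (M N : Matrix (Fin n) (Fin n) ℝ) :
    ∑ i, (M.updateRow i (N i)).det = (M.adjugate * N).trace := by
  have h : ∀ i, (M.updateRow i (N i)).det = ∑ j, N i j * M.adjugate j i := by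
    intro i
    rw [Matrix.det_eq_sum_mul_adjugate_row _ i]
    refine Finset.sum_congr rfl fun j _ => ?_
    rw [Matrix.updateRow_self, Matrix.adjugate_apply, Matrix.adjugate_apply,
      Matrix.updateRow_idem]
  simp only [h, Matrix.trace, Matrix.diag_apply, Matrix.mul_apply]
  rw [Finset.sum_comm]
  exact Finset.sum_congr rfl fun j _ => Finset.sum_congr rfl fun i _ => mul_comm _ _

/-- Jacobi's formula. The form within a set serves both spatial derivatives and one-sided time
derivatives at the ends of the interval. -/
theorem hasFDerivWithinAt_det {E : Type*} [NormedAddCommGroup E] [NormedSpace ℝ E]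
    {A : E → Matrix (Fin n) (Fin n) ℝ} {x : E} {A' : Fin n → Fin n → E →L[ℝ] ℝ} {s : Set E}
    (hA : ∀ a b, HasFDerivWithinAt (fun z => A z a b) (A' a b) s x) :
    HasFDerivWithinAt (fun z => (A z).det)
      (∑ a, ∑ b, (A x).adjugate b a • A' a b) s x := by
  have h1 : HasFDerivWithinAt (fun z => (A z).det)
      (∑ σ : Equiv.Perm (Fin n), ((Equiv.Perm.sign σ : ℤ) : ℝ) •
        ∑ j, (∏ k ∈ Finset.univ.erase j, A x (σ k) k) • A' (σ j) j) s x := by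
    simp only [Matrix.det_apply']
    refine HasFDerivWithinAt.fun_sum fun σ _ => ?_
    exact (HasFDerivWithinAt.finsetProd fun j _ => hA (σ j) j).const_mul _
  convert h1 using 1
  ext v
  set N : Matrix (Fin n) (Fin n) ℝ := Matrix.of fun a b => A' a b v with hN
  -- The factors in `Matrix.det_apply'` are indexed by columns, so the product rule replaces one
  -- column at a time; transposing brings this to the row form.
  have h2 := sum_det_updateRow (A x)ᵀ Nᵀ
  have h3 : ((A x)ᵀ.adjugate * Nᵀ).trace = ∑ a, ∑ b, (A x).adjugate b a * A' a b v := by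
    rw [← Matrix.adjugate_transpose, ← Matrix.transpose_mul, Matrix.trace_transpose]
    simp [Matrix.trace, Matrix.mul_apply, hN, mul_comm]
  simp only [sum_apply, smul_apply, smul_eq_mul]
  rw [← h3, ← h2]
  simp only [Matrix.updateRow_transpose, Matrix.det_transpose]
  simp only [Matrix.det_apply', Finset.mul_sum]
  rw [Finset.sum_comm]
  refine Finset.sum_congr rfl fun σ _ => Finset.sum_congr rfl fun j _ => ?_
  rw [← Finset.mul_prod_erase _ _ (Finset.mem_univ j), Matrix.updateCol_self, mul_comm (_ : ℝ) (∏ _ ∈ _, _)]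
  congr 1
  congr 1
  refine Finset.prod_congr rfl fun k hk => ?_
  rw [Matrix.updateCol_ne (Finset.ne_of_mem_erase hk)]

theorem pd_det {A : Comp2 n} {y : Coord n} (hA : SmoothAt2 A y) (i : Fin n) :
    pd i (fun z => (A z).det) y = ((A y).adjugate * pdM i A y).trace := by
  have h := hasFDerivWithinAt_det (s := univ) fun a b =>
    (hA.differentiableAt a b).hasFDerivAt.hasFDerivWithinAt
  rw [hasFDerivWithinAt_univ] at h
  rw [pd, h.fderiv]
  simp only [sum_apply, smul_apply, smul_eq_mul,
    Matrix.trace, Matrix.diag_apply, Matrix.mul_apply, pdM_apply, pd]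
  rw [Finset.sum_comm]

theorem pd_sqrt_det {A : Comp2 n} {y : Coord n} (hA : SmoothAt2 A y) (hd : 0 < (A y).det)
    (i : Fin n) :
    pd i (fun z => Real.sqrt (A z).det) y =
      1 / 2 * Real.sqrt (A y).det * (ginv A y * pdM i A y).trace := by
  have h := (hA.det.differentiableAt (by simp)).hasFDerivAt.sqrt hd.ne'
  rw [pd, h.fderiv]
  have h2 := pd_det hA i
  rw [pd] at h2
  have h3 := Real.mul_self_sqrt hd.le
  have h4 := (Real.sqrt_pos.mpr hd).ne'
  simp only [smul_apply, smul_eq_mul, h2, ginv, Matrix.inv_def,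
    Ring.inverse_eq_inv', Matrix.smul_mul, Matrix.trace_smul]
  field_simp
  rw [sq, h3, mul_comm]

/-! ### The Levi-Civita connection in matrix form -/

/-- The connection matrices `(A_k)^a_m = Γ^a_{km}`. -/
def conn (G : Comp2 n) (k : Fin n) (y : Coord n) : Matrix (Fin n) (Fin n) ℝ :=
  Matrix.of fun a m => christoffel G y a k m

@[simp] theorem conn_apply (G : Comp2 n) (k : Fin n) (y : Coord n) (a m : Fin n) :
    conn G k y a m = christoffel G y a k m := rfl

/-- The Christoffel symbols of the first kind,
`Γ_{ij,b} = ½ (∂_i g_{jb} + ∂_j g_{ib} - ∂_b g_{ij})`. -/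
def christoffelLow (G : Comp2 n) (y : Coord n) (b i j : Fin n) : ℝ :=
  (1 / 2) * (pd i (fun z => G z j b) y + pd j (fun z => G z i b) y - pd b (fun z => G z i j) y)

/-- `G` gives the components of a smooth Riemannian metric near `y`. -/
structure IsMetricAt (G : Comp2 n) (y : Coord n) : Prop where
  smooth : SmoothAt2 G y
  symm : ∀ᶠ z in 𝓝 y, (G z)ᵀ = G z
  det_pos : 0 < (G y).det

namespace IsMetricAt

variable {G : Comp2 n} {y : Coord n}

/-- Being `C^∞` at a point, in the sense of `ContDiffAt`, does not give `C^∞` at nearby points,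
since the neighbourhood may shrink with the order; hence the separate hypothesis `hs`. -/
theorem eventually (hG : IsMetricAt G y) (hs : ∀ᶠ z in 𝓝 y, SmoothAt2 G z) :
    ∀ᶠ z in 𝓝 y, IsMetricAt G z := by
  filter_upwards [hs, hG.symm.eventually_nhds,
    hG.smooth.det.continuousAt.eventually (lt_mem_nhds hG.det_pos)] with z h1 h2 h3
  exact ⟨h1, h2, h3⟩

theorem isUnit_det (hG : IsMetricAt G y) : IsUnit (G y).det :=
  isUnit_iff_ne_zero.mpr hG.det_pos.ne'

theorem ginv_mul (hG : IsMetricAt G y) : ginv G y * G y = 1 :=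
  Matrix.nonsing_inv_mul _ hG.isUnit_det

theorem mul_ginv (hG : IsMetricAt G y) : G y * ginv G y = 1 :=
  Matrix.mul_nonsing_inv _ hG.isUnit_det

theorem smooth_ginv (hG : IsMetricAt G y) : SmoothAt2 (ginv G) y :=
  hG.smooth.ginv hG.det_pos.ne'

theorem ginv_transpose (hG : IsMetricAt G y) : (ginv G y)ᵀ = ginv G y := by
  rw [ginv, Matrix.transpose_nonsing_inv, hG.symm.self_of_nhds]

theorem ginv_comm (hG : IsMetricAt G y) (a b : Fin n) : ginv G y a b = ginv G y b a := by
  conv_lhs => rw [← hG.ginv_transpose, Matrix.transpose_apply]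

theorem pd_symm (hG : IsMetricAt G y) (i a b : Fin n) :
    pd i (fun z => G z a b) y = pd i (fun z => G z b a) y :=
  pd_congr (hG.symm.mono fun z hz => by
    change G z a b = G z b a
    conv_lhs => rw [← hz, Matrix.transpose_apply])

theorem christoffel_symm (hG : IsMetricAt G y) (k i j : Fin n) :
    christoffel G y k i j = christoffel G y k j i := by
  simp only [christoffel]
  congr 1
  refine Finset.sum_congr rfl fun l _ => ?_
  rw [hG.pd_symm l i j]
  ring

theorem smooth_christoffel (hG : IsMetricAt G y) (k i j : Fin n) :
    ContDiffAt ℝ ∞ (fun z => christoffel G z k i j) y := by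
  unfold christoffel
  refine contDiffAt_const.mul (ContDiffAt.sum fun l _ => (hG.smooth_ginv k l).mul ?_)
  exact ((contDiffAt_pd (hG.smooth _ _)).add (contDiffAt_pd (hG.smooth _ _))).sub
    (contDiffAt_pd (hG.smooth _ _))

theorem smooth_conn (hG : IsMetricAt G y) (k : Fin n) : SmoothAt2 (conn G k) y := fun a m =>
  hG.smooth_christoffel a k m

/-- Symbols of the first kind contain no inverse metric, so compatibility, curvature symmetries and
coordinate changes are checked on them. -/
theorem mul_conn (hG : IsMetricAt G y) (k : Fin n) :
    G y * conn G k y = Matrix.of fun b m => christoffelLow G y b k m := by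
  have h : conn G k y = ginv G y * Matrix.of fun b m => christoffelLow G y b k m := by
    ext a m
    simp only [conn_apply, christoffel, christoffelLow, Matrix.mul_apply, Matrix.of_apply,
      Finset.mul_sum]
    exact Finset.sum_congr rfl fun l _ => by ring
  rw [h, ← Matrix.mul_assoc, hG.mul_ginv, Matrix.one_mul]

theorem sum_christoffel_mul (hG : IsMetricAt G y) (b i j : Fin n) :
    ∑ l, christoffel G y l i j * G y l b = christoffelLow G y b i j := by
  have h := congrFun (congrFun (hG.mul_conn i) b) j
  simp only [Matrix.mul_apply, Matrix.of_apply, conn_apply] at h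
  rw [← h]
  refine Finset.sum_congr rfl fun l _ => ?_
  rw [mul_comm]
  congr 1
  conv_lhs => rw [← hG.symm.self_of_nhds, Matrix.transpose_apply]

theorem pd_eq_christoffelLow (hG : IsMetricAt G y) (a b t : Fin n) :
    pd a (fun z => G z t b) y = christoffelLow G y b a t + christoffelLow G y t a b := by
  simp only [christoffelLow]
  rw [hG.pd_symm a b t, hG.pd_symm t a b, hG.pd_symm b a t]
  ring

/-- Metric compatibility of the Levi-Civita connection. -/
theorem pdM_eq (hG : IsMetricAt G y) (k : Fin n) :
    pdM k G y = G y * conn G k y + (conn G k y)ᵀ * G y := by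
  have h2 : (conn G k y)ᵀ * G y = (G y * conn G k y)ᵀ := by
    rw [Matrix.transpose_mul, hG.symm.self_of_nhds]
  rw [h2, hG.mul_conn]
  ext a b
  simp only [pdM_apply, Matrix.add_apply, Matrix.of_apply, Matrix.transpose_apply]
  rw [hG.pd_eq_christoffelLow, add_comm]

theorem pdM_ginv_eq (hG : IsMetricAt G y) (k : Fin n) :
    pdM k (ginv G) y = -(conn G k y * ginv G y + ginv G y * (conn G k y)ᵀ) := by
  rw [pdM_ginv hG.smooth hG.det_pos.ne', hG.pdM_eq, Matrix.mul_add, ← Matrix.mul_assoc,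
    hG.ginv_mul, Matrix.one_mul, Matrix.add_mul, Matrix.mul_assoc (ginv G y),
    Matrix.mul_assoc (_ᵀ), hG.mul_ginv, Matrix.mul_one]

/-- Jacobi's formula and metric compatibility: both terms of `g⁻¹ ∂_k g` have the trace of the
connection matrix, which absorbs the factor `1 / 2`. -/
theorem pd_sqrt_det_eq (hG : IsMetricAt G y) (k : Fin n) :
    pd k (fun z => Real.sqrt (G z).det) y =
      Real.sqrt (G y).det * ∑ m, christoffel G y m k m := by
  rw [pd_sqrt_det hG.smooth hG.det_pos, hG.pdM_eq, Matrix.mul_add, ← Matrix.mul_assoc,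
    hG.ginv_mul, Matrix.one_mul, Matrix.trace_add, Matrix.trace_mul_comm (ginv G y),
    Matrix.mul_assoc, hG.mul_ginv, Matrix.mul_one, Matrix.trace_transpose]
  simp only [Matrix.trace, Matrix.diag_apply, conn_apply]
  ring

/-- `∂_k (√g g^{kl}) = - √g g^{km} Γ^l_{km}`. -/
theorem sum_pd_sqrt_det_ginv (hG : IsMetricAt G y) (l : Fin n) :
    ∑ k, pd k (fun z => Real.sqrt (G z).det * ginv G z k l) y =
      -(Real.sqrt (G y).det * ∑ k, ∑ m, ginv G y k m * christoffel G y l k m) := by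
  have hs : DifferentiableAt ℝ (fun z => Real.sqrt (G z).det) y :=
    (hG.smooth.det.sqrt hG.det_pos.ne').differentiableAt (by simp)
  have h1 : ∀ k, pd k (fun z => Real.sqrt (G z).det * ginv G z k l) y =
      Real.sqrt (G y).det * (∑ m, christoffel G y m k m * ginv G y k l
        - ∑ m, christoffel G y k m k * ginv G y m l
        - ∑ m, ginv G y k m * christoffel G y l k m) := by
    intro k
    rw [pd_mul hs (hG.smooth_ginv.differentiableAt k l), hG.pd_sqrt_det_eq]
    have h := congrFun (congrFun (hG.pdM_ginv_eq k) k) l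
    simp only [pdM_apply, Matrix.neg_apply, Matrix.add_apply, Matrix.mul_apply, conn_apply,
      Matrix.transpose_apply] at h
    rw [h, ← Finset.sum_mul]
    simp only [fun m => hG.christoffel_symm k k m]
    ring
  -- Once the names of `k` and `m` are exchanged in the second sum, it cancels the first: the trace
  -- from `√g` against one of the two terms from `∂ g⁻¹`.
  rw [Finset.sum_congr rfl fun k _ => h1 k, ← Finset.mul_sum, Finset.sum_sub_distrib,
    Finset.sum_sub_distrib, Finset.sum_comm (f := fun k m => christoffel G y k m k * _)]
  ring

end IsMetricAt

/-! ### Symmetries of the curvature tensor -/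

theorem riemann_antisymm_left (G : Comp2 n) (y : Coord n) (a s b t : Fin n) :
    riemann G y a s b t = -riemann G y s a b t := by
  simp only [riemann, ← Finset.sum_neg_distrib]
  refine Finset.sum_congr rfl fun l _ => ?_
  simp only [curvEndo, Finset.sum_sub_distrib]
  ring

namespace IsMetricAt

variable {G : Comp2 n} {y : Coord n}

theorem smooth_christoffelLow (hG : IsMetricAt G y) (b i j : Fin n) :
    ContDiffAt ℝ ∞ (fun z => christoffelLow G z b i j) y :=
  contDiffAt_const.mul (((contDiffAt_pd (hG.smooth _ _)).add (contDiffAt_pd (hG.smooth _ _))).sub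
    (contDiffAt_pd (hG.smooth _ _)))

/-- Lowering an index does not commute with `∂_a`; the defect `Γ ∂g` is written with symbols of the
first kind. -/
theorem sum_pd_christoffel_mul (hG : IsMetricAt G y) (hs : ∀ᶠ z in 𝓝 y, SmoothAt2 G z)
    (a s t b : Fin n) :
    ∑ l, pd a (fun z => christoffel G z l s t) y * G y l b =
      pd a (fun z => christoffelLow G z b s t) y
        - ∑ l, christoffel G y l s t * christoffelLow G y b a l
        - ∑ l, christoffel G y l s t * christoffelLow G y l a b := by
  have h1 : pd a (fun z => ∑ l, christoffel G z l s t * G z l b) y =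
      pd a (fun z => christoffelLow G z b s t) y :=
    pd_congr ((hG.eventually hs).mono fun z hz => hz.sum_christoffel_mul b s t)
  rw [pd_sum fun l _ => ((hG.smooth_christoffel l s t).differentiableAt (by simp)).fun_mul
    (hG.smooth.differentiableAt l b)] at h1
  rw [← h1, ← Finset.sum_sub_distrib, ← Finset.sum_sub_distrib]
  refine Finset.sum_congr rfl fun l _ => ?_
  rw [pd_mul ((hG.smooth_christoffel l s t).differentiableAt (by simp))
    (hG.smooth.differentiableAt l b), hG.pd_eq_christoffelLow]
  ring

/-- Of the two quadratic terms produced by each lowered derivative, one cancels the explicit `ΓΓ`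
term of the curvature. -/
theorem riemann_eq (hG : IsMetricAt G y) (hs : ∀ᶠ z in 𝓝 y, SmoothAt2 G z) (a s b t : Fin n) :
    riemann G y a s b t = pd a (fun z => christoffelLow G z b s t) y
      - pd s (fun z => christoffelLow G z b a t) y
      - ∑ l, christoffel G y l s t * christoffelLow G y l a b
      + ∑ l, christoffel G y l a t * christoffelLow G y l s b := by
  have h1 : ∀ i j k : Fin n,
      ∑ l, (∑ m, christoffel G y m j k * christoffel G y l i m) * G y l b =
        ∑ m, christoffel G y m j k * christoffelLow G y b i m := by
    intro i j k
    simp only [Finset.sum_mul]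
    rw [Finset.sum_comm]
    refine Finset.sum_congr rfl fun m _ => ?_
    rw [← hG.sum_christoffel_mul, Finset.mul_sum]
    exact Finset.sum_congr rfl fun l _ => by ring
  have h2 : riemann G y a s b t =
      ∑ l, pd a (fun z => christoffel G z l s t) y * G y l b
      - ∑ l, pd s (fun z => christoffel G z l a t) y * G y l b
      + (∑ l, (∑ m, christoffel G y m s t * christoffel G y l a m) * G y l b
        - ∑ l, (∑ m, christoffel G y m a t * christoffel G y l s m) * G y l b) := by
    simp only [riemann, curvEndo, ← Finset.sum_sub_distrib, ← Finset.sum_add_distrib]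
    refine Finset.sum_congr rfl fun l _ => ?_
    simp only [Finset.sum_sub_distrib]
    ring
  rw [h2, h1, h1, hG.sum_pd_christoffel_mul hs, hG.sum_pd_christoffel_mul hs]
  ring

/-- Both sides are the `g`-inner product of the vectors `Γ_{ij}` and `Γ_{km}`. -/
theorem sum_christoffel_mul_christoffelLow_comm (hG : IsMetricAt G y) (i j k m : Fin n) :
    ∑ l, christoffel G y l i j * christoffelLow G y l k m =
      ∑ l, christoffel G y l k m * christoffelLow G y l i j := by
  simp only [← hG.sum_christoffel_mul, Finset.mul_sum]
  rw [Finset.sum_comm]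
  refine Finset.sum_congr rfl fun l _ => Finset.sum_congr rfl fun l' _ => ?_
  rw [show G y l l' = G y l' l by conv_lhs => rw [← hG.symm.self_of_nhds, Matrix.transpose_apply]]
  ring

/-- By metric compatibility the derivative terms add up to the commutator of `∂_a` and `∂_s` on
`g_{tb}`, which vanishes; the quadratic terms cancel in pairs. -/
theorem riemann_antisymm_right (hG : IsMetricAt G y) (hs : ∀ᶠ z in 𝓝 y, SmoothAt2 G z)
    (a s b t : Fin n) : riemann G y a s b t = -riemann G y a s t b := by
  have h1 : ∀ i j : Fin n, pd i (fun z => christoffelLow G z b j t) y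
      + pd i (fun z => christoffelLow G z t j b) y = pd i (pd j fun z => G z t b) y := by
    intro i j
    rw [← pd_add ((hG.smooth_christoffelLow _ _ _).differentiableAt (by simp))
      ((hG.smooth_christoffelLow _ _ _).differentiableAt (by simp))]
    exact pd_congr ((hG.eventually hs).mono fun z hz => (hz.pd_eq_christoffelLow j b t).symm)
  have h2 := pd_comm (hG.smooth t b) a s
  rw [hG.riemann_eq hs, hG.riemann_eq hs, hG.sum_christoffel_mul_christoffelLow_comm s t,
    hG.sum_christoffel_mul_christoffelLow_comm a t]
  linarith [h1 a s, h1 s a]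

/-- The only curvature symmetry that self-adjointness of `Δ_L` requires of the Riemann term; the
exchange of the two pairs, which needs Bianchi, is avoided. -/
theorem riemann_swap (hG : IsMetricAt G y) (hs : ∀ᶠ z in 𝓝 y, SmoothAt2 G z)
    (a s b t : Fin n) : riemann G y a s b t = riemann G y s a t b := by
  rw [riemann_antisymm_left, hG.riemann_antisymm_right hs, neg_neg]

end IsMetricAt

/-! ### The full contraction of two-index arrays -/

/-- The full contraction `X^{ab} Y_{ab}`. -/
def dot2 (X Y : Matrix (Fin n) (Fin n) ℝ) : ℝ := ∑ a, ∑ b, X a b * Y a b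

section dot2

variable (A X X' Y Y' : Matrix (Fin n) (Fin n) ℝ)

theorem dot2_eq_trace : dot2 X Y = (Xᵀ * Y).trace := by
  simp only [dot2, Matrix.trace, Matrix.diag_apply, Matrix.mul_apply, Matrix.transpose_apply]
  exact Finset.sum_comm

theorem dot2_add_left : dot2 (X + X') Y = dot2 X Y + dot2 X' Y := by
  simp [dot2_eq_trace, add_mul]

theorem dot2_sub_left : dot2 (X - X') Y = dot2 X Y - dot2 X' Y := by
  simp [dot2_eq_trace, sub_mul]

theorem dot2_add_right : dot2 X (Y + Y') = dot2 X Y + dot2 X Y' := by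
  simp [dot2_eq_trace, mul_add]

theorem dot2_sub_right : dot2 X (Y - Y') = dot2 X Y - dot2 X Y' := by
  simp [dot2_eq_trace, mul_sub]

theorem dot2_smul_left (c : ℝ) : dot2 (c • X) Y = c * dot2 X Y := by
  simp [dot2_eq_trace]

theorem dot2_smul_right (c : ℝ) : dot2 X (c • Y) = c * dot2 X Y := by
  simp [dot2_eq_trace]

theorem dot2_sum_left {ι : Type*} (s : Finset ι) (F : ι → Matrix (Fin n) (Fin n) ℝ) :
    dot2 (∑ i ∈ s, F i) Y = ∑ i ∈ s, dot2 (F i) Y := by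
  simp [dot2_eq_trace, Matrix.transpose_sum, Matrix.sum_mul, Matrix.trace_sum]

theorem dot2_sum_right {ι : Type*} (s : Finset ι) (F : ι → Matrix (Fin n) (Fin n) ℝ) :
    dot2 X (∑ i ∈ s, F i) = ∑ i ∈ s, dot2 X (F i) := by
  simp [dot2_eq_trace, Matrix.mul_sum, Matrix.trace_sum]

theorem dot2_mul_left : dot2 (A * X) Y = dot2 X (Aᵀ * Y) := by
  simp [dot2_eq_trace, Matrix.mul_assoc]

theorem dot2_mul_right : dot2 (X * A) Y = dot2 X (Y * Aᵀ) := by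
  rw [dot2_eq_trace, dot2_eq_trace, Matrix.transpose_mul, Matrix.mul_assoc, Matrix.trace_mul_comm,
    Matrix.mul_assoc]

end dot2

theorem pd_dot2 {A B : Comp2 n} {y : Coord n} (hA : SmoothAt2 A y) (hB : SmoothAt2 B y)
    (k : Fin n) :
    pd k (fun z => dot2 (A z) (B z)) y = dot2 (pdM k A y) (B y) + dot2 (A y) (pdM k B y) := by
  have hd := fun a b => (hA.differentiableAt a b).fun_mul (hB.differentiableAt a b)
  simp only [dot2, ← Finset.sum_add_distrib]
  rw [pd_sum fun a _ => DifferentiableAt.fun_sum fun b _ => hd a b]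
  refine Finset.sum_congr rfl fun a _ => ?_
  rw [pd_sum fun b _ => hd a b]
  exact Finset.sum_congr rfl fun b _ => pd_mul (hA.differentiableAt a b) (hB.differentiableAt a b)

theorem contDiffAt_dot2 {A B : Comp2 n} {y : Coord n} (hA : SmoothAt2 A y) (hB : SmoothAt2 B y) :
    ContDiffAt ℝ ∞ (fun z => dot2 (A z) (B z)) y :=
  ContDiffAt.sum fun a _ => ContDiffAt.sum fun b _ => (hA a b).mul (hB a b)

/-! ### Covariant derivatives in matrix form -/

/-- The matrix `(∇_k h)_{ab}`. -/
def covM (G h : Comp2 n) (k : Fin n) : Comp2 n := fun y => Matrix.of (covD G h y k)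

/-- The matrix `(∇_k H)^{ab}`. -/
def conM (G H : Comp2 n) (k : Fin n) : Comp2 n := fun y => Matrix.of (conD G H y k)

section Matrices

variable {G h H : Comp2 n} {y : Coord n}

/-- In matrix form the connection acts on `h` by `-(Aᵀ h + h A)` and on `H` by `A H + H Aᵀ`. These
are negative adjoints for `dot2`, whence the Leibniz rule for the contraction. -/
theorem covM_eq (k : Fin n) :
    covM G h k y = pdM k h y - (conn G k y)ᵀ * h y - h y * conn G k y := by
  ext a b
  simp [covM, covD, Matrix.mul_apply, mul_comm]

theorem conM_eq (k : Fin n) :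
    conM G H k y = pdM k H y + conn G k y * H y + H y * (conn G k y)ᵀ := by
  ext a b
  simp [conM, conD, Matrix.mul_apply, mul_comm]

theorem covDD_eq (l k : Fin n) :
    Matrix.of (covDD G h y l k) = pdM l (covM G h k) y
      - ∑ m, christoffel G y m l k • covM G h m y
      - (conn G l y)ᵀ * covM G h k y - covM G h k y * conn G l y := by
  ext a b
  simp [covM, covDD, Matrix.mul_apply, Matrix.sum_apply, mul_comm]

theorem conDD_eq (l k : Fin n) :
    Matrix.of (conDD G H y l k) = pdM l (conM G H k) y
      - ∑ m, christoffel G y m l k • conM G H m y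
      + conn G l y * conM G H k y + conM G H k y * (conn G l y)ᵀ := by
  ext a b
  simp [conM, conDD, Matrix.mul_apply, Matrix.sum_apply, mul_comm]

theorem SmoothAt2.add {A B : Comp2 n} (hA : SmoothAt2 A y) (hB : SmoothAt2 B y) :
    SmoothAt2 (fun z => A z + B z) y := fun a b => (hA a b).add (hB a b)

theorem SmoothAt2.sub {A B : Comp2 n} (hA : SmoothAt2 A y) (hB : SmoothAt2 B y) :
    SmoothAt2 (fun z => A z - B z) y := fun a b => (hA a b).sub (hB a b)

theorem smoothAt2_covM (hG : IsMetricAt G y) (hh : SmoothAt2 h y) (k : Fin n) :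
    SmoothAt2 (covM G h k) y := by
  have h1 : covM G h k = fun z => pdM k h z - (conn G k z)ᵀ * h z - h z * conn G k z :=
    funext fun z => covM_eq k
  rw [h1]
  exact ((hh.pdM k).sub ((hG.smooth_conn k).transpose.mul hh)).sub (hh.mul (hG.smooth_conn k))

theorem smoothAt2_conM (hG : IsMetricAt G y) (hH : SmoothAt2 H y) (k : Fin n) :
    SmoothAt2 (conM G H k) y := by
  have h1 : conM G H k = fun z => pdM k H z + conn G k z * H z + H z * (conn G k z)ᵀ :=
    funext fun z => conM_eq k
  rw [h1]
  exact ((hH.pdM k).add ((hG.smooth_conn k).mul hH)).add (hH.mul (hG.smooth_conn k).transpose)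

end Matrices

/-! ### Green's identity for the Lichnerowicz Laplacian -/

/-- The covector `S_l = ∇_l H^{ab} h_{ab} - H^{ab} ∇_l h_{ab}`. -/
def wronskian (G H h : Comp2 n) (l : Fin n) (y : Coord n) : ℝ :=
  dot2 (conM G H l y) (h y) - dot2 (H y) (covM G h l y)

/-- The density `√g g^{kl} S_l`. -/
def flux (G H h : Comp2 n) (k : Fin n) (y : Coord n) : ℝ :=
  ∑ l, (Real.sqrt (G y).det * ginv G y k l) * wronskian G H h l y

section Green

variable {G h H : Comp2 n} {y : Coord n}

theorem contDiffAt_wronskian (hG : IsMetricAt G y) (hH : SmoothAt2 H y) (hh : SmoothAt2 h y)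
    (l : Fin n) : ContDiffAt ℝ ∞ (wronskian G H h l) y :=
  (contDiffAt_dot2 (smoothAt2_conM hG hH l) hh).sub (contDiffAt_dot2 hH (smoothAt2_covM hG hh l))

theorem contDiffAt_sqrt_det_mul_ginv (hG : IsMetricAt G y) (k l : Fin n) :
    ContDiffAt ℝ ∞ (fun z => Real.sqrt (G z).det * ginv G z k l) y :=
  (hG.smooth.det.sqrt hG.det_pos.ne').mul (hG.smooth_ginv k l)

theorem contDiffAt_flux (hG : IsMetricAt G y) (hH : SmoothAt2 H y) (hh : SmoothAt2 h y)
    (k : Fin n) : ContDiffAt ℝ ∞ (flux G H h k) y :=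
  ContDiffAt.sum fun l _ => (contDiffAt_sqrt_det_mul_ginv hG k l).mul (contDiffAt_wronskian hG hH hh l)

/-- The connection terms on the contracted indices cancel by adjointness. There remain the symbol
acting on the index `l` and a bracket of first derivatives, antisymmetric in `k, l`. -/
theorem pd_wronskian (hG : IsMetricAt G y) (hH : SmoothAt2 H y) (hh : SmoothAt2 h y)
    (k l : Fin n) :
    pd k (wronskian G H h l) y =
      dot2 (Matrix.of (conDD G H y k l)) (h y) - dot2 (H y) (Matrix.of (covDD G h y k l))
        + ∑ m, christoffel G y m k l * wronskian G H h m y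
        + (dot2 (conM G H l y) (covM G h k y) - dot2 (conM G H k y) (covM G h l y)) := by
  have hC := smoothAt2_conM hG hH l
  have hD := smoothAt2_covM hG hh l
  have e1 : pdM k h y = covM G h k y + (conn G k y)ᵀ * h y + h y * conn G k y := by
    rw [covM_eq]; abel
  have e2 : pdM k H y = conM G H k y - conn G k y * H y - H y * (conn G k y)ᵀ := by
    rw [conM_eq]; abel
  have e3 : pdM k (covM G h l) y = Matrix.of (covDD G h y k l)
      + ∑ m, christoffel G y m k l • covM G h m y
      + (conn G k y)ᵀ * covM G h l y + covM G h l y * conn G k y := by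
    rw [covDD_eq]; abel
  have e4 : pdM k (conM G H l) y = Matrix.of (conDD G H y k l)
      + ∑ m, christoffel G y m k l • conM G H m y
      - conn G k y * conM G H l y - conM G H l y * (conn G k y)ᵀ := by
    rw [conDD_eq]; abel
  have e5 : pd k (wronskian G H h l) y = _ :=
    pd_sub ((contDiffAt_dot2 hC hh).differentiableAt (by simp))
      ((contDiffAt_dot2 hH hD).differentiableAt (by simp))
  rw [e5, pd_dot2 hC hh, pd_dot2 hH hD, e1, e2, e3, e4]
  have m1 : ∀ X Y, dot2 (conn G k y * X) Y = dot2 X ((conn G k y)ᵀ * Y) := dot2_mul_left _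
  have m2 : ∀ X Y, dot2 (X * (conn G k y)ᵀ) Y = dot2 X (Y * conn G k y) := fun X Y => by
    rw [dot2_mul_right, Matrix.transpose_transpose]
  simp only [dot2_add_left, dot2_sub_left, dot2_add_right, m1, m2,
    dot2_sum_left, dot2_sum_right, dot2_smul_left, dot2_smul_right,
    wronskian, mul_sub, Finset.sum_sub_distrib]
  ring

/-- The curvature terms of the two Lichnerowicz Laplacians are adjoint to each other. -/
theorem curvature_terms (hG : IsMetricAt G y) (hs : ∀ᶠ z in 𝓝 y, SmoothAt2 G z)
    (hRic : ∀ a b, ricci G y a b = ricci G y b a) (hH : (H y)ᵀ = H y) (hh : (h y)ᵀ = h y) :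
    dot2 (Matrix.of (lichCon G H y)) (h y) - dot2 (H y) (Matrix.of (lichCov G h y)) =
      ∑ k, ∑ l, ginv G y k l *
        (dot2 (Matrix.of (conDD G H y k l)) (h y) - dot2 (H y) (Matrix.of (covDD G h y k l))) := by
  set g := ginv G y with hg
  set Ric : Matrix (Fin n) (Fin n) ℝ := Matrix.of (ricci G y) with hRicdef
  have hRicT : Ricᵀ = Ric := by ext a b; exact hRic b a
  have hgT : gᵀ = g := hG.ginv_transpose
  set P : Matrix (Fin n) (Fin n) ℝ := Matrix.of fun a b =>
    ∑ s, ∑ t, (∑ u, ∑ v, g a u * g b v * riemann G y u s v t) * H y s t with hP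
  set Q : Matrix (Fin n) (Fin n) ℝ := Matrix.of fun a b =>
    ∑ s, ∑ t, riemann G y a s b t * ∑ u, ∑ v, g s u * g t v * h y u v with hQ
  have e1 : Matrix.of (lichCon G H y) = ∑ k, ∑ l, g k l • Matrix.of (conDD G H y k l)
      - g * Ric * H y - H y * Ric * g + (2 : ℝ) • P := by
    ext a b
    have r1 : ∑ s, ∑ u, (g a u * ricci G y u s) * H y b s = (g * Ric * (H y)ᵀ) a b := by
      simp [Matrix.mul_apply, Finset.sum_mul, hRicdef]
    have r2 : ∑ s, ∑ u, (g b u * ricci G y u s) * H y a s = (H y * Ricᵀ * gᵀ) a b := by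
      rw [Matrix.mul_assoc]
      simp only [Matrix.mul_apply, Finset.mul_sum, hRicdef, Matrix.transpose_apply, Matrix.of_apply]
      exact Finset.sum_congr rfl fun s _ => Finset.sum_congr rfl fun u _ => by ring
    rw [hH] at r1
    rw [hRicT, hgT] at r2
    simp only [lichCon, Matrix.of_apply, ← hg, r1, r2, Matrix.add_apply, Matrix.sub_apply,
      Matrix.sum_apply, Matrix.smul_apply, smul_eq_mul, hP]
  have e2 : Matrix.of (lichCov G h y) = ∑ k, ∑ l, g k l • Matrix.of (covDD G h y k l)
      - Ric * g * h y - h y * g * Ric + (2 : ℝ) • Q := by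
    ext a b
    have r1 : ∑ s, ∑ u, ricci G y a s * (g s u * h y b u) = (Ric * g * (h y)ᵀ) a b := by
      rw [Matrix.mul_assoc]
      simp [Matrix.mul_apply, Finset.mul_sum, hRicdef]
    have r2 : ∑ s, ∑ u, ricci G y b s * (g s u * h y a u) = (h y * gᵀ * Ricᵀ) a b := by
      simp only [Matrix.mul_apply, Finset.sum_mul, hRicdef, Matrix.transpose_apply, Matrix.of_apply]
      exact Finset.sum_congr rfl fun s _ => Finset.sum_congr rfl fun u _ => by ring
    rw [hh] at r1
    rw [hRicT, hgT] at r2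
    simp only [lichCov, Matrix.of_apply, ← hg, r1, r2, Matrix.add_apply, Matrix.sub_apply,
      Matrix.sum_apply, Matrix.smul_apply, smul_eq_mul, hQ]
  have e3 : dot2 P (h y) = dot2 (H y) Q := by
    have p1 : dot2 P (h y) = ∑ p : (Fin n × Fin n) × (Fin n × Fin n) × (Fin n × Fin n),
        g p.1.1 p.2.2.1 * g p.1.2 p.2.2.2 * riemann G y p.2.2.1 p.2.1.1 p.2.2.2 p.2.1.2 *
          H y p.2.1.1 p.2.1.2 * h y p.1.1 p.1.2 := by
      simp only [Fintype.sum_prod_type, dot2, hP, Matrix.of_apply, Finset.sum_mul]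
    have p2 : dot2 (H y) Q = ∑ p : (Fin n × Fin n) × (Fin n × Fin n) × (Fin n × Fin n),
        H y p.1.1 p.1.2 * (riemann G y p.1.1 p.2.1.1 p.1.2 p.2.1.2 *
          (g p.2.1.1 p.2.2.1 * g p.2.1.2 p.2.2.2 * h y p.2.2.1 p.2.2.2)) := by
      simp only [Fintype.sum_prod_type, dot2, hQ, Matrix.of_apply, Finset.mul_sum]
    rw [p1, p2]
    -- A cyclic relabelling of the three index pairs matches `H` with `H` and `h` with `h`; what is
    -- left is the symmetry of `g⁻¹` and a simultaneous swap in both pairs of the Riemann tensor.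
    let e : ((Fin n × Fin n) × (Fin n × Fin n) × (Fin n × Fin n)) ≃
        ((Fin n × Fin n) × (Fin n × Fin n) × (Fin n × Fin n)) :=
      { toFun := fun p => (p.2.1, p.2.2, p.1)
        invFun := fun p => (p.2.2, p.1, p.2.1)
        left_inv := fun _ => rfl
        right_inv := fun _ => rfl }
    refine Fintype.sum_equiv e _ _ fun p => ?_
    simp only [e, Equiv.coe_fn_mk]
    have hgc : ∀ a b, g a b = g b a := hG.ginv_comm
    rw [hG.riemann_swap hs p.2.1.1 p.2.2.1, hgc p.2.2.1 p.1.1, hgc p.2.2.2 p.1.2]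
    ring
  rw [e1, e2]
  simp only [dot2_add_left, dot2_sub_left, dot2_add_right, dot2_sub_right, dot2_sum_left,
    dot2_sum_right, dot2_smul_left, dot2_smul_right, mul_sub, Finset.sum_sub_distrib, e3]
  -- Since `g⁻¹` and `Ric` are symmetric, `g⁻¹ Ric` and `Ric g⁻¹` are transposes of each other.
  have e4 : dot2 (g * Ric * H y) (h y) = dot2 (H y) (Ric * g * h y) := by
    rw [dot2_mul_left, Matrix.transpose_mul, hgT, hRicT]
  have e5 : dot2 (H y * Ric * g) (h y) = dot2 (H y) (h y * g * Ric) := by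
    rw [dot2_mul_right, dot2_mul_right, hgT, hRicT]
  rw [e4, e5]
  ring

/-- Green's identity: `√g (Δ_L H^{ab} h_{ab} - H^{ab} Δ_L h_{ab})` is a divergence. -/
theorem sum_pd_flux (hG : IsMetricAt G y) (hs : ∀ᶠ z in 𝓝 y, SmoothAt2 G z)
    (hRic : ∀ a b, ricci G y a b = ricci G y b a) (hH : SmoothAt2 H y) (hh : SmoothAt2 h y)
    (hHs : (H y)ᵀ = H y) (hhs : (h y)ᵀ = h y) :
    ∑ k, pd k (flux G H h k) y = Real.sqrt (G y).det *
      (dot2 (Matrix.of (lichCon G H y)) (h y) - dot2 (H y) (Matrix.of (lichCov G h y))) := by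
  have hd1 := fun k l => (contDiffAt_sqrt_det_mul_ginv hG k l).differentiableAt (by simp)
  have hd2 := fun l => (contDiffAt_wronskian hG hH hh l).differentiableAt (by simp)
  have h1 : ∀ k, pd k (flux G H h k) y =
      ∑ l, pd k (fun z => Real.sqrt (G z).det * ginv G z k l) y * wronskian G H h l y
      + ∑ l, (Real.sqrt (G y).det * ginv G y k l) * pd k (wronskian G H h l) y := by
    intro k
    have : pd k (flux G H h k) y = _ := pd_sum fun l _ => (hd1 k l).fun_mul (hd2 l)
    rw [this, ← Finset.sum_add_distrib]
    exact Finset.sum_congr rfl fun l _ => pd_mul (hd1 k l) (hd2 l)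
  -- This term will cancel exactly the Christoffel term that `pd_wronskian` leaves on the free
  -- index.
  have h2 : ∑ k, ∑ l, pd k (fun z => Real.sqrt (G z).det * ginv G z k l) y * wronskian G H h l y =
      -(Real.sqrt (G y).det * ∑ k, ∑ m, ginv G y k m *
        ∑ l, christoffel G y l k m * wronskian G H h l y) := by
    rw [Finset.sum_comm]
    simp only [← Finset.sum_mul, hG.sum_pd_sqrt_det_ginv, Finset.mul_sum]
    rw [← Finset.sum_neg_distrib]
    simp only [neg_mul, Finset.sum_neg_distrib, Finset.sum_mul]
    congr 1
    rw [Finset.sum_comm]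
    refine Finset.sum_congr rfl fun k _ => ?_
    rw [Finset.sum_comm]
    exact Finset.sum_congr rfl fun m _ => Finset.sum_congr rfl fun l _ => by ring
  -- An antisymmetric bracket contracted with the symmetric `g^{kl}`.
  have h3 : ∑ k, ∑ l, ginv G y k l *
      (dot2 (conM G H l y) (covM G h k y) - dot2 (conM G H k y) (covM G h l y)) = 0 := by
    simp only [mul_sub, Finset.sum_sub_distrib]
    rw [sub_eq_zero, Finset.sum_comm]
    exact Finset.sum_congr rfl fun k _ => Finset.sum_congr rfl fun l _ => by rw [hG.ginv_comm]
  rw [Finset.sum_congr rfl fun k _ => h1 k, Finset.sum_add_distrib, h2,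
    curvature_terms hG hs hRic hHs hhs]
  simp only [mul_assoc, ← Finset.mul_sum]
  rw [← mul_neg, ← mul_add]
  congr 1
  simp only [pd_wronskian hG hH hh, mul_add, Finset.sum_add_distrib, h3]
  ring

end Green

/-! ### Change of coordinates -/

/-- The Jacobian matrix `J^i_a = ∂_a τ^i`. -/
def jac (τ : Coord n → Coord n) : Comp2 n := fun y =>
  Matrix.of fun i a => pd a (fun w => τ w i) y

@[simp] theorem jac_apply (τ : Coord n → Coord n) (y : Coord n) (i a : Fin n) :
    jac τ y i a = pd a (fun w => τ w i) y := rfl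

section ChainRule

variable {τ : Coord n → Coord n} {y : Coord n}

theorem jac_eq_fderiv (hτ : DifferentiableAt ℝ τ y) (i a : Fin n) :
    jac τ y i a = fderiv ℝ τ y (EuclideanSpace.single a 1) i := by
  have h := (EuclideanSpace.proj (𝕜 := ℝ) i : Coord n →L[ℝ] ℝ).hasFDerivAt.comp y hτ.hasFDerivAt
  have h2 : fderiv ℝ (fun w => τ w i) y = _ := h.fderiv
  rw [jac_apply, pd, h2]
  rfl

theorem fderiv_single (hτ : DifferentiableAt ℝ τ y) (a : Fin n) :
    fderiv ℝ τ y (EuclideanSpace.single a 1) = ∑ i, jac τ y i a • EuclideanSpace.single i 1 := by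
  ext j
  rw [← jac_eq_fderiv hτ]
  simp [Finset.sum_apply, Pi.single_apply]

theorem det_fderiv (hτ : DifferentiableAt ℝ τ y) :
    (fderiv ℝ τ y).det = (jac τ y).det := by
  have h : jac τ y = LinearMap.toMatrix (EuclideanSpace.basisFun (Fin n) ℝ).toBasis
      (EuclideanSpace.basisFun (Fin n) ℝ).toBasis (fderiv ℝ τ y : Coord n →ₗ[ℝ] Coord n) := by
    ext i a
    rw [jac_eq_fderiv hτ, LinearMap.toMatrix_apply]
    simp
  rw [h, LinearMap.det_toMatrix]

theorem pd_comp {f : Coord n → ℝ} (hτ : DifferentiableAt ℝ τ y)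
    (hf : DifferentiableAt ℝ f (τ y)) (a : Fin n) :
    pd a (fun z => f (τ z)) y = ∑ i, jac τ y i a * pd i f (τ y) := by
  have h : fderiv ℝ (fun z => f (τ z)) y = _ := (hf.hasFDerivAt.comp y hτ.hasFDerivAt).fderiv
  rw [pd, h, ContinuousLinearMap.comp_apply, fderiv_single hτ, map_sum]
  simp [pd]

theorem contDiffAt_apply (hτ : ContDiffAt ℝ ∞ τ y) (i : Fin n) :
    ContDiffAt ℝ ∞ (fun w => τ w i) y :=
  (EuclideanSpace.proj (𝕜 := ℝ) i : Coord n →L[ℝ] ℝ).contDiff.contDiffAt.comp y hτ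

theorem smoothAt2_jac (hτ : ContDiffAt ℝ ∞ τ y) : SmoothAt2 (jac τ) y := fun i _ =>
  contDiffAt_pd (contDiffAt_apply hτ i)

theorem pd_jac_symm (hτ : ContDiffAt ℝ ∞ τ y) (i a b : Fin n) :
    pd a (fun z => jac τ z i b) y = pd b (fun z => jac τ z i a) y :=
  pd_comm (contDiffAt_apply hτ i) a b

theorem SmoothAt2.comp {B : Comp2 n} (hτ : ContDiffAt ℝ ∞ τ y) (hB : SmoothAt2 B (τ y)) :
    SmoothAt2 (fun z => B (τ z)) y := fun a b => (hB a b).comp y hτ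

theorem pdM_comp {B : Comp2 n} (hτ : DifferentiableAt ℝ τ y) (hB : SmoothAt2 B (τ y))
    (a : Fin n) :
    pdM a (fun z => B (τ z)) y = ∑ i, jac τ y i a • pdM i B (τ y) := by
  ext b c
  rw [pdM_apply, pd_comp hτ (hB.differentiableAt b c)]
  simp [Matrix.sum_apply]

end ChainRule

/-- The cubic form `∑ J^k_l J^i_m J^j_b T_{kij}`. -/
def pull3 (J : Matrix (Fin n) (Fin n) ℝ) (T : Fin n → Fin n → Fin n → ℝ) (l m b : Fin n) : ℝ :=
  ∑ k, ∑ i, ∑ j, J k l * J i m * J j b * T k i j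

theorem pull3_swap12 (J : Matrix (Fin n) (Fin n) ℝ) (T : Fin n → Fin n → Fin n → ℝ)
    (l m b : Fin n) : pull3 J T l m b = pull3 J (fun k i j => T i k j) m l b := by
  unfold pull3
  rw [Finset.sum_comm]
  exact Finset.sum_congr rfl fun _ _ => Finset.sum_congr rfl fun _ _ =>
    Finset.sum_congr rfl fun _ _ => by ring

theorem pull3_swap23 (J : Matrix (Fin n) (Fin n) ℝ) (T : Fin n → Fin n → Fin n → ℝ)
    (l m b : Fin n) : pull3 J T l m b = pull3 J (fun k i j => T k j i) l b m := by
  unfold pull3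
  refine Finset.sum_congr rfl fun _ _ => ?_
  rw [Finset.sum_comm]
  exact Finset.sum_congr rfl fun _ _ => Finset.sum_congr rfl fun _ _ => by ring

theorem transpose_mul_sum_smul_mul (J : Matrix (Fin n) (Fin n) ℝ)
    (F : Fin n → Matrix (Fin n) (Fin n) ℝ) (l m b : Fin n) :
    (Jᵀ * (∑ k, J k l • F k) * J) m b = pull3 J (fun k i j => F k i j) l m b := by
  simp only [Matrix.mul_sum, Matrix.sum_mul, Matrix.sum_apply, Matrix.mul_smul,
    Matrix.smul_mul, Matrix.smul_apply, smul_eq_mul]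
  simp only [pull3, Matrix.mul_apply, Matrix.transpose_apply, Finset.mul_sum, Finset.sum_mul]
  refine Finset.sum_congr rfl fun k _ => ?_
  rw [Finset.sum_comm]
  exact Finset.sum_congr rfl fun _ _ => Finset.sum_congr rfl fun _ _ => by ring

section Transform

variable {τ : Coord n → Coord n} {y : Coord n} {G G' h h' H H' : Comp2 n}

/-- A singular Jacobian would make `G` degenerate, so invertibility comes from the metric and needs
no inverse coordinate change. -/
theorem det_jac_ne_zero (hG : IsMetricAt G y)
    (hGG : ∀ᶠ z in 𝓝 y, G z = (jac τ z)ᵀ * G' (τ z) * jac τ z) : (jac τ y).det ≠ 0 := by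
  intro h0
  have := hG.det_pos
  rw [hGG.self_of_nhds, Matrix.det_mul, h0, mul_zero] at this
  exact lt_irrefl _ this

/-- The transformation law of the Christoffel symbols. -/
theorem jac_mul_conn (hτ : ContDiffAt ℝ ∞ τ y) (hG : IsMetricAt G y) (hG' : IsMetricAt G' (τ y))
    (hGG : ∀ᶠ z in 𝓝 y, G z = (jac τ z)ᵀ * G' (τ z) * jac τ z) (l : Fin n) :
    jac τ y * conn G l y =
      pdM l (jac τ) y + (∑ k, jac τ y k l • conn G' k (τ y)) * jac τ y := by
  set J := jac τ y with hJ
  have hJd : IsUnit J.det := isUnit_iff_ne_zero.mpr (det_jac_ne_zero hG hGG)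
  have hτd : DifferentiableAt ℝ τ y := hτ.differentiableAt (by simp)
  have hsJ := smoothAt2_jac hτ
  have hsG' := hG'.smooth.comp hτ
  have hdG : ∀ a, pdM a G y = ((J)ᵀ * G' (τ y) * pdM a (jac τ) y)ᵀ
      + Jᵀ * (∑ k, J k a • pdM k G' (τ y)) * J + Jᵀ * G' (τ y) * pdM a (jac τ) y := by
    intro a
    rw [pdM_congr hGG, pdM_mul (hsJ.transpose.mul hsG') hsJ, pdM_mul hsJ.transpose hsG',
      pdM_transpose, pdM_comp hτd hG'.smooth, Matrix.transpose_mul, Matrix.transpose_mul,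
      Matrix.transpose_transpose, hG'.symm.self_of_nhds, ← hJ]
    noncomm_ring
  -- The second derivatives of `τ`, lowered with the metric. They are symmetric in the last two
  -- indices, which is what makes the next cancellations work.
  set x : Fin n → Fin n → Fin n → ℝ := fun b a m => (Jᵀ * G' (τ y) * pdM a (jac τ) y) b m with hx
  have hxs : ∀ b a m, x b a m = x b m a := by
    intro b a m
    simp only [hx, Matrix.mul_apply (M := Jᵀ * G' (τ y)), pdM_apply]
    exact Finset.sum_congr rfl fun i _ => by rw [pd_jac_symm hτ]
  set T : Fin n → Fin n → Fin n → ℝ := fun k i j => pdM k G' (τ y) i j with hT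
  have hpd : ∀ a m b, pd a (fun z => G z m b) y = x m a b + x b a m + pull3 J T a m b := by
    intro a m b
    have := congrFun (congrFun (hdG a) m) b
    simp only [pdM_apply, Matrix.add_apply, Matrix.transpose_apply] at this
    rw [this, transpose_mul_sum_smul_mul]
    simp only [hx]
    ring
  -- Of the six second-derivative terms in the first-kind symbol, four cancel by the symmetry of `x`
  -- and two coincide, absorbing the factor `1 / 2`.
  have hlow : ∀ b m, christoffelLow G y b l m = x b l m
      + pull3 J (fun k i j => christoffelLow G' (τ y) i k j) l b m := by
    intro b m
    have e1 : pull3 J (fun k i j => christoffelLow G' (τ y) i k j) l b m =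
        1 / 2 * (pull3 J (fun k i j => T k j i) l b m + pull3 J (fun k i j => T j k i) l b m
          - pull3 J (fun k i j => T i k j) l b m) := by
      simp only [pull3, ← Finset.sum_add_distrib, ← Finset.sum_sub_distrib, Finset.mul_sum]
      refine Finset.sum_congr rfl fun k _ => Finset.sum_congr rfl fun i _ =>
        Finset.sum_congr rfl fun j _ => ?_
      simp only [christoffelLow, hT, pdM_apply]
      ring
    rw [e1, ← pull3_swap23 J T l m b, ← pull3_swap12 J T b l m,
      pull3_swap23 J (fun k i j => T j k i) l b m, ← pull3_swap12 J T m l b]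
    simp only [christoffelLow, hpd]
    rw [hxs m b l, hxs l b m, hxs b m l]
    ring
  -- The law is proved with its index lowered, that is multiplied by the invertible matrix `Jᵀ G'`,
  -- which is cancelled at the end.
  have hkey : Jᵀ * G' (τ y) * (J * conn G l y) =
      Jᵀ * G' (τ y) * (pdM l (jac τ) y + (∑ k, J k l • conn G' k (τ y)) * J) := by
    have e1 : Jᵀ * G' (τ y) * (J * conn G l y) = G y * conn G l y := by
      rw [hGG.self_of_nhds, Matrix.mul_assoc (Jᵀ * G' (τ y))]
    have e2 : Jᵀ * G' (τ y) * ((∑ k, J k l • conn G' k (τ y)) * J) =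
        Jᵀ * (∑ k, J k l • (G' (τ y) * conn G' k (τ y))) * J := by
      simp only [← Matrix.mul_smul, ← Matrix.mul_sum, Matrix.mul_assoc]
    rw [e1, hG.mul_conn, Matrix.mul_add, e2]
    ext b m
    rw [Matrix.of_apply, hlow, Matrix.add_apply, transpose_mul_sum_smul_mul]
    simp only [hG'.mul_conn, Matrix.of_apply, hx]
  have hu : IsUnit (Jᵀ * G' (τ y)) := by
    rw [Matrix.isUnit_iff_isUnit_det, Matrix.det_mul, Matrix.det_transpose]
    exact hJd.mul hG'.isUnit_det
  exact hu.mul_left_cancel hkey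

/-- The covariant derivative of a covariant tensor is tensorial. -/
theorem covM_transform (hτ : ContDiffAt ℝ ∞ τ y) (hG : IsMetricAt G y)
    (hG' : IsMetricAt G' (τ y)) (hGG : ∀ᶠ z in 𝓝 y, G z = (jac τ z)ᵀ * G' (τ z) * jac τ z)
    (hh' : SmoothAt2 h' (τ y)) (hhh : ∀ᶠ z in 𝓝 y, h z = (jac τ z)ᵀ * h' (τ z) * jac τ z)
    (l : Fin n) :
    covM G h l y = (jac τ y)ᵀ * (∑ k, jac τ y k l • covM G' h' k (τ y)) * jac τ y := by
  have hτd : DifferentiableAt ℝ τ y := hτ.differentiableAt (by simp)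
  have hsJ := smoothAt2_jac hτ
  have hc := jac_mul_conn hτ hG hG' hGG l
  have hsum : ∑ k, jac τ y k l • covM G' h' k (τ y) = ∑ k, jac τ y k l • pdM k h' (τ y)
      - (∑ k, jac τ y k l • conn G' k (τ y))ᵀ * h' (τ y)
      - h' (τ y) * ∑ k, jac τ y k l • conn G' k (τ y) := by
    simp only [covM_eq, smul_sub, Finset.sum_sub_distrib, Matrix.transpose_sum,
      Matrix.transpose_smul, Matrix.sum_mul, Matrix.mul_sum, Matrix.smul_mul, Matrix.mul_smul]
  rw [covM_eq, pdM_congr hhh, pdM_mul (hsJ.transpose.mul (hh'.comp hτ)) hsJ,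
    pdM_mul hsJ.transpose (hh'.comp hτ), pdM_transpose, pdM_comp hτd hh', hhh.self_of_nhds, hsum]
  have e1 : (conn G l y)ᵀ * ((jac τ y)ᵀ * h' (τ y) * jac τ y) =
      (jac τ y * conn G l y)ᵀ * (h' (τ y) * jac τ y) := by
    rw [Matrix.transpose_mul]; noncomm_ring
  have e2 : (jac τ y)ᵀ * h' (τ y) * jac τ y * conn G l y =
      (jac τ y)ᵀ * h' (τ y) * (jac τ y * conn G l y) := by
    noncomm_ring
  rw [e1, e2, hc, Matrix.transpose_add, Matrix.transpose_mul]
  noncomm_ring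

/-- The covariant derivative of a contravariant tensor is tensorial. -/
theorem conM_transform (hτ : ContDiffAt ℝ ∞ τ y) (hG : IsMetricAt G y)
    (hG' : IsMetricAt G' (τ y)) (hGG : ∀ᶠ z in 𝓝 y, G z = (jac τ z)ᵀ * G' (τ z) * jac τ z)
    (hH : SmoothAt2 H y) (hH' : SmoothAt2 H' (τ y))
    (hHH : ∀ᶠ z in 𝓝 y, H' (τ z) = jac τ z * H z * (jac τ z)ᵀ) (l : Fin n) :
    jac τ y * conM G H l y * (jac τ y)ᵀ = ∑ k, jac τ y k l • conM G' H' k (τ y) := by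
  have hτd : DifferentiableAt ℝ τ y := hτ.differentiableAt (by simp)
  have hsJ := smoothAt2_jac hτ
  have hc := jac_mul_conn hτ hG hG' hGG l
  have hsum : ∑ k, jac τ y k l • conM G' H' k (τ y) = ∑ k, jac τ y k l • pdM k H' (τ y)
      + (∑ k, jac τ y k l • conn G' k (τ y)) * H' (τ y)
      + H' (τ y) * (∑ k, jac τ y k l • conn G' k (τ y))ᵀ := by
    simp only [conM_eq, smul_add, Finset.sum_add_distrib, Matrix.transpose_sum,
      Matrix.transpose_smul, Matrix.sum_mul, Matrix.mul_sum, Matrix.smul_mul, Matrix.mul_smul]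
  rw [hsum, ← pdM_comp hτd hH', pdM_congr hHH, pdM_mul (hsJ.mul hH) hsJ.transpose,
    pdM_mul hsJ hH, pdM_transpose, hHH.self_of_nhds, conM_eq]
  have e1 : jac τ y * (pdM l H y + conn G l y * H y + H y * (conn G l y)ᵀ) * (jac τ y)ᵀ =
      jac τ y * pdM l H y * (jac τ y)ᵀ + (jac τ y * conn G l y) * H y * (jac τ y)ᵀ
        + jac τ y * H y * (jac τ y * conn G l y)ᵀ := by
    rw [Matrix.transpose_mul]; noncomm_ring
  rw [e1, hc, Matrix.transpose_add, Matrix.transpose_mul]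
  noncomm_ring

/-- Pushing `H` forward is adjoint to pulling `h` back; this makes the contraction independent of
the chart without ever inverting `J`. -/
theorem dot2_conj (J X Y : Matrix (Fin n) (Fin n) ℝ) :
    dot2 (J * X * Jᵀ) Y = dot2 X (Jᵀ * Y * J) := by
  rw [dot2_mul_right, dot2_mul_left, Matrix.transpose_transpose, Matrix.mul_assoc]

theorem wronskian_transform (hτ : ContDiffAt ℝ ∞ τ y) (hG : IsMetricAt G y)
    (hG' : IsMetricAt G' (τ y)) (hGG : ∀ᶠ z in 𝓝 y, G z = (jac τ z)ᵀ * G' (τ z) * jac τ z)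
    (hh' : SmoothAt2 h' (τ y)) (hhh : ∀ᶠ z in 𝓝 y, h z = (jac τ z)ᵀ * h' (τ z) * jac τ z)
    (hH : SmoothAt2 H y) (hH' : SmoothAt2 H' (τ y))
    (hHH : ∀ᶠ z in 𝓝 y, H' (τ z) = jac τ z * H z * (jac τ z)ᵀ) (l : Fin n) :
    wronskian G H h l y = ∑ k, jac τ y k l * wronskian G' H' h' k (τ y) := by
  rw [wronskian, covM_transform hτ hG hG' hGG hh' hhh, hhh.self_of_nhds, ← dot2_conj, ← dot2_conj,
    conM_transform hτ hG hG' hGG hH hH' hHH, ← hHH.self_of_nhds]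
  simp only [dot2_sum_left, dot2_sum_right, dot2_smul_left, dot2_smul_right, wronskian, mul_sub,
    Finset.sum_sub_distrib]

theorem sqrt_det_transform (hGG : G y = (jac τ y)ᵀ * G' (τ y) * jac τ y) :
    Real.sqrt (G y).det = |(jac τ y).det| * Real.sqrt (G' (τ y)).det := by
  rw [hGG, Matrix.det_mul, Matrix.det_mul, Matrix.det_transpose,
    show (jac τ y).det * (G' (τ y)).det * (jac τ y).det =
      (jac τ y).det ^ 2 * (G' (τ y)).det by ring, Real.sqrt_mul (sq_nonneg _), Real.sqrt_sq_eq_abs]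

theorem ginv_transform (hG : IsMetricAt G y)
    (hGG : ∀ᶠ z in 𝓝 y, G z = (jac τ z)ᵀ * G' (τ z) * jac τ z) :
    jac τ y * ginv G y * (jac τ y)ᵀ = ginv G' (τ y) := by
  have hJd : IsUnit (jac τ y).det := isUnit_iff_ne_zero.mpr (det_jac_ne_zero hG hGG)
  have hJT : IsUnit ((jac τ y)ᵀ).det := by rwa [Matrix.det_transpose]
  rw [ginv, hGG.self_of_nhds, Matrix.mul_inv_rev, Matrix.mul_inv_rev, ← Matrix.mul_assoc,
    Matrix.mul_nonsing_inv _ hJd, Matrix.one_mul, Matrix.mul_assoc, Matrix.nonsing_inv_mul _ hJT,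
    Matrix.mul_one, ginv]

/-- The pairing of the flux density with the differential of a function is a density. -/
theorem sum_flux_mul_pd_transform (hτ : ContDiffAt ℝ ∞ τ y) (hG : IsMetricAt G y)
    (hG' : IsMetricAt G' (τ y)) (hGG : ∀ᶠ z in 𝓝 y, G z = (jac τ z)ᵀ * G' (τ z) * jac τ z)
    (hh' : SmoothAt2 h' (τ y)) (hhh : ∀ᶠ z in 𝓝 y, h z = (jac τ z)ᵀ * h' (τ z) * jac τ z)
    (hH : SmoothAt2 H y) (hH' : SmoothAt2 H' (τ y))
    (hHH : ∀ᶠ z in 𝓝 y, H' (τ z) = jac τ z * H z * (jac τ z)ᵀ)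
    {f f' : Coord n → ℝ} (hf' : DifferentiableAt ℝ f' (τ y))
    (hff : ∀ᶠ z in 𝓝 y, f z = f' (τ z)) :
    ∑ k, flux G H h k y * pd k f y =
      |(jac τ y).det| * ∑ k, flux G' H' h' k (τ y) * pd k f' (τ y) := by
  have hS := wronskian_transform hτ hG hG' hGG hh' hhh hH hH' hHH
  have hp : ∀ k, pd k f y = ∑ i, jac τ y i k * pd i f' (τ y) := fun k => by
    rw [pd_congr hff, pd_comp (hτ.differentiableAt (by simp)) hf']
  set S' : Fin n → ℝ := fun k => wronskian G' H' h' k (τ y)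
  set D' : Fin n → ℝ := fun k => pd k f' (τ y)
  have e1 : ∑ k, flux G H h k y * pd k f y = Real.sqrt (G y).det *
      ((fun k => pd k f y) ⬝ᵥ (ginv G y *ᵥ fun l => wronskian G H h l y)) := by
    simp only [flux, dotProduct, Matrix.mulVec, Finset.mul_sum, Finset.sum_mul]
    exact Finset.sum_congr rfl fun k _ => Finset.sum_congr rfl fun l _ => by ring
  have e2 : ∑ k, flux G' H' h' k (τ y) * pd k f' (τ y) = Real.sqrt (G' (τ y)).det *
      (D' ⬝ᵥ (ginv G' (τ y) *ᵥ S')) := by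
    simp only [flux, dotProduct, Matrix.mulVec, Finset.mul_sum, Finset.sum_mul, S', D']
    exact Finset.sum_congr rfl fun k _ => Finset.sum_congr rfl fun l _ => by ring
  have e3 : (fun l => wronskian G H h l y) = (jac τ y)ᵀ *ᵥ S' := by
    ext l
    simp only [hS, Matrix.mulVec, dotProduct, Matrix.transpose_apply, S']
  have e4 : (fun k => pd k f y) = (jac τ y)ᵀ *ᵥ D' := by
    ext l
    simp only [hp, Matrix.mulVec, dotProduct, Matrix.transpose_apply, D']
  -- The sum is `√g` times the scalar `g⁻¹(df, S)`; only `√g` contributes a factor, the absolute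
  -- Jacobian determinant.
  rw [e1, e2, e3, e4, sqrt_det_transform hGG.self_of_nhds, ← ginv_transform hG hGG,
    Matrix.mulVec_transpose, ← Matrix.dotProduct_mulVec, Matrix.mulVec_mulVec,
    Matrix.mulVec_mulVec, mul_assoc]

end Transform

end

/-! ### Tensor fields on the manifold read in charts. -/

section

variable {n : ℕ} {M : Type*} [TopologicalSpace M] [ChartedSpace (Coord n) M]

/-! ### Components of tensor fields in different charts -/

/-- The differential of the inverse of a chart, read in the model space. -/
def frameVec (φ : OpenPartialHomeomorph M (Coord n)) (y : Coord n) : Coord n →L[ℝ] Coord n :=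
  mfderiv (𝓡 n) (𝓡 n) φ.symm y

/-- The differential of a chart, read in the model space. -/
def coframeVec (φ : OpenPartialHomeomorph M (Coord n)) (x : M) : Coord n →L[ℝ] Coord n :=
  mfderiv (𝓡 n) (𝓡 n) φ x

/-- A covariant tensor field, read in the model space. -/
def covEval (h : CovTensor n M) (x : M) : Coord n →L[ℝ] Coord n →L[ℝ] ℝ := h x

/-- A contravariant tensor field, read in the model space. -/
def conEval (H : ConTensor n M) (x : M) : (Coord n →L[ℝ] ℝ) →L[ℝ] (Coord n →L[ℝ] ℝ) →L[ℝ] ℝ := H x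

theorem covComp_eq (φ : OpenPartialHomeomorph M (Coord n)) (h : CovTensor n M) (y : Coord n)
    (a b : Fin n) : covComp φ h y a b = covEval h (φ.symm y)
      (frameVec φ y (EuclideanSpace.single a 1)) (frameVec φ y (EuclideanSpace.single b 1)) := rfl

theorem conComp_eq (φ : OpenPartialHomeomorph M (Coord n)) (H : ConTensor n M) (y : Coord n)
    (a b : Fin n) : conComp φ H y a b = conEval H (φ.symm y)
      ((EuclideanSpace.proj (𝕜 := ℝ) a).comp (coframeVec φ (φ.symm y)))
      ((EuclideanSpace.proj (𝕜 := ℝ) b).comp (coframeVec φ (φ.symm y))) := rfl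

theorem bilin_sum {V : Type*} [NormedAddCommGroup V] [NormedSpace ℝ V] {ι : Type*} (s t : Finset ι)
    (B : V →L[ℝ] V →L[ℝ] ℝ) (c d : ι → ℝ) (v w : ι → V) :
    B (∑ i ∈ s, c i • v i) (∑ j ∈ t, d j • w j) = ∑ i ∈ s, ∑ j ∈ t, c i * d j * B (v i) (w j) := by
  simp only [map_sum, map_smul, sum_apply, smul_apply, smul_eq_mul, Finset.mul_sum]
  rw [Finset.sum_comm]
  exact Finset.sum_congr rfl fun i _ => Finset.sum_congr rfl fun j _ => by ring

/-- The coordinate change `ψ ∘ φ⁻¹`. -/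
def transition (φ ψ : OpenPartialHomeomorph M (Coord n)) : Coord n → Coord n :=
  fun y => ψ (φ.symm y)

/-- The domain of `ψ ∘ φ⁻¹`. -/
def overlap (φ ψ : OpenPartialHomeomorph M (Coord n)) : Set (Coord n) :=
  φ.target ∩ φ.symm ⁻¹' ψ.source

theorem isOpen_overlap (φ ψ : OpenPartialHomeomorph M (Coord n)) : IsOpen (overlap φ ψ) :=
  φ.isOpen_inter_preimage_symm ψ.open_source

section Transition

variable {φ ψ : OpenPartialHomeomorph M (Coord n)} {y : Coord n}

theorem symm_transition (hy : y ∈ overlap φ ψ) : ψ.symm (transition φ ψ y) = φ.symm y :=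
  ψ.left_inv hy.2

theorem transition_mem_overlap (hy : y ∈ overlap φ ψ) : transition φ ψ y ∈ overlap ψ φ := by
  refine ⟨ψ.map_source hy.2, ?_⟩
  rw [mem_preimage, symm_transition hy]
  exact φ.map_target hy.1

theorem transition_transition (hy : y ∈ overlap φ ψ) :
    transition ψ φ (transition φ ψ y) = y := by
  rw [transition, symm_transition hy, φ.right_inv hy.1]

theorem injOn_transition : InjOn (transition φ ψ) (overlap φ ψ) := fun y hy z hz h => by
  rw [← transition_transition hy, h, transition_transition hz]

theorem image_transition : transition φ ψ '' overlap φ ψ = overlap ψ φ := by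
  ext z
  constructor
  · rintro ⟨y, hy, rfl⟩
    exact transition_mem_overlap hy
  · intro hz
    exact ⟨transition ψ φ z, transition_mem_overlap hz, transition_transition hz⟩

variable [IsManifold (𝓡 n) ∞ M]

theorem isManifold_one : IsManifold (𝓡 n) 1 M := IsManifold.of_le (n := ∞) (by simp)

theorem contDiffAt_transition (hφ : φ ∈ atlas (Coord n) M) (hψ : ψ ∈ atlas (Coord n) M)
    (hy : y ∈ overlap φ ψ) : ContDiffAt ℝ ∞ (transition φ ψ) y := by
  have h1 : ContMDiffAt (𝓡 n) (𝓡 n) ∞ φ.symm y :=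
    contMDiffAt_symm_of_mem_maximalAtlas (IsManifold.subset_maximalAtlas hφ) hy.1
  have h2 : ContMDiffAt (𝓡 n) (𝓡 n) ∞ ψ (φ.symm y) :=
    contMDiffAt_of_mem_maximalAtlas (IsManifold.subset_maximalAtlas hψ) hy.2
  exact contMDiffAt_iff_contDiffAt.mp (h2.comp y h1)

theorem mdifferentiableAt_chart (hφ : φ ∈ atlas (Coord n) M) {x : M} (hx : x ∈ φ.source) :
    MDifferentiableAt (𝓡 n) (𝓡 n) φ x :=
  haveI := isManifold_one (n := n) (M := M)
  mdifferentiableAt_atlas hφ hx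

theorem mdifferentiableAt_chart_symm (hφ : φ ∈ atlas (Coord n) M) (hy : y ∈ φ.target) :
    MDifferentiableAt (𝓡 n) (𝓡 n) φ.symm y :=
  haveI := isManifold_one (n := n) (M := M)
  mdifferentiableAt_atlas_symm hφ hy

theorem frameVec_transition (hφ : φ ∈ atlas (Coord n) M) (hψ : ψ ∈ atlas (Coord n) M)
    (hy : y ∈ overlap φ ψ) :
    frameVec φ y = (frameVec ψ (transition φ ψ y)).comp (fderiv ℝ (transition φ ψ) y) := by
  have h1 : MDifferentiableAt (𝓡 n) (𝓡 n) ψ.symm (transition φ ψ y) :=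
    mdifferentiableAt_chart_symm hψ (transition_mem_overlap hy).1
  have h2 : MDifferentiableAt (𝓡 n) (𝓡 n) (transition φ ψ) y :=
    ((contDiffAt_transition hφ hψ hy).differentiableAt (by simp)).mdifferentiableAt
  have h3 : (φ.symm : Coord n → M) =ᶠ[𝓝 y] ψ.symm ∘ transition φ ψ := by
    filter_upwards [(isOpen_overlap φ ψ).mem_nhds hy] with z hz
    exact (symm_transition hz).symm
  have h4 : mfderiv (𝓡 n) (𝓡 n) (transition φ ψ) y = fderiv ℝ (transition φ ψ) y :=
    mfderiv_eq_fderiv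
  have h5 : mfderiv (𝓡 n) (𝓡 n) (ψ.symm ∘ transition φ ψ) y = _ := mfderiv_comp y h1 h2
  have h6 : frameVec φ y = mfderiv (𝓡 n) (𝓡 n) (ψ.symm ∘ transition φ ψ) y :=
    h3.mfderiv_eq
  rw [h6, h5, h4]
  rfl

theorem coframeVec_transition (hφ : φ ∈ atlas (Coord n) M) (hψ : ψ ∈ atlas (Coord n) M)
    (hy : y ∈ overlap φ ψ) :
    coframeVec ψ (φ.symm y) = (fderiv ℝ (transition φ ψ) y).comp (coframeVec φ (φ.symm y)) := by
  set x := φ.symm y with hx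
  have hxφ : x ∈ φ.source := φ.map_target hy.1
  have hyx : φ x = y := φ.right_inv hy.1
  have h1 : MDifferentiableAt (𝓡 n) (𝓡 n) φ x := mdifferentiableAt_chart hφ hxφ
  have h2 : MDifferentiableAt (𝓡 n) (𝓡 n) (transition φ ψ) (φ x) := by
    rw [hyx]
    exact ((contDiffAt_transition hφ hψ hy).differentiableAt (by simp)).mdifferentiableAt
  have h3 : (ψ : M → Coord n) =ᶠ[𝓝 x] transition φ ψ ∘ φ := by
    filter_upwards [φ.open_source.mem_nhds hxφ] with z hz
    simp [transition, φ.left_inv hz]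
  have h4 : mfderiv (𝓡 n) (𝓡 n) (transition φ ψ) (φ x) = fderiv ℝ (transition φ ψ) (φ x) :=
    mfderiv_eq_fderiv
  have h5 : mfderiv (𝓡 n) (𝓡 n) (transition φ ψ ∘ φ) x = _ := mfderiv_comp x h2 h1
  have h6 : coframeVec ψ x = mfderiv (𝓡 n) (𝓡 n) (transition φ ψ ∘ φ) x := h3.mfderiv_eq
  rw [h6, h5, h4, hyx]
  rfl

theorem covComp_transition (hφ : φ ∈ atlas (Coord n) M) (hψ : ψ ∈ atlas (Coord n) M)
    (h : CovTensor n M) (hy : y ∈ overlap φ ψ) :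
    covComp φ h y = (jac (transition φ ψ) y)ᵀ * covComp ψ h (transition φ ψ y)
      * jac (transition φ ψ) y := by
  have hd := (contDiffAt_transition hφ hψ hy).differentiableAt (by simp)
  ext a b
  rw [covComp_eq, frameVec_transition hφ hψ hy]
  simp only [ContinuousLinearMap.comp_apply, fderiv_single hd, map_sum, map_smul,
    sum_apply, smul_apply, smul_eq_mul, Matrix.mul_apply, Matrix.transpose_apply, covComp_eq,
    symm_transition hy, Finset.sum_mul, Finset.mul_sum]
  refine Finset.sum_congr rfl fun i _ => Finset.sum_congr rfl fun j _ => ?_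
  ring

theorem proj_comp_fderiv {τ : Coord n → Coord n} (hτ : DifferentiableAt ℝ τ y) (i : Fin n) :
    (EuclideanSpace.proj (𝕜 := ℝ) i : Coord n →L[ℝ] ℝ).comp (fderiv ℝ τ y) =
      ∑ a, jac τ y i a • (EuclideanSpace.proj (𝕜 := ℝ) a : Coord n →L[ℝ] ℝ) := by
  refine ContinuousLinearMap.coe_injective
    ((EuclideanSpace.basisFun (Fin n) ℝ).toBasis.ext fun b => ?_)
  simp [jac_eq_fderiv hτ, -jac_apply]

theorem conComp_transition (hφ : φ ∈ atlas (Coord n) M) (hψ : ψ ∈ atlas (Coord n) M)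
    (H : ConTensor n M) (hy : y ∈ overlap φ ψ) :
    conComp ψ H (transition φ ψ y) = jac (transition φ ψ) y * conComp φ H y
      * (jac (transition φ ψ) y)ᵀ := by
  have hd := (contDiffAt_transition hφ hψ hy).differentiableAt (by simp)
  ext a b
  rw [conComp_eq, symm_transition hy, coframeVec_transition hφ hψ hy]
  have hc : ∀ a : Fin n, (EuclideanSpace.proj (𝕜 := ℝ) a : Coord n →L[ℝ] ℝ).comp
      ((fderiv ℝ (transition φ ψ) y).comp (coframeVec φ (φ.symm y))) =
      ∑ i, jac (transition φ ψ) y a i •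
        (EuclideanSpace.proj (𝕜 := ℝ) i : Coord n →L[ℝ] ℝ).comp (coframeVec φ (φ.symm y)) := by
    intro a
    rw [← ContinuousLinearMap.comp_assoc, proj_comp_fderiv hd]
    ext v
    simp
  rw [hc, hc, bilin_sum]
  simp only [Matrix.mul_apply, Matrix.transpose_apply, conComp_eq, Finset.sum_mul]
  rw [Finset.sum_comm]
  exact Finset.sum_congr rfl fun i _ => Finset.sum_congr rfl fun j _ => by ring

theorem dot2_comp_transition (hφ : φ ∈ atlas (Coord n) M) (hψ : ψ ∈ atlas (Coord n) M)
    (H : ConTensor n M) (h : CovTensor n M) (hy : y ∈ overlap φ ψ) :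
    dot2 (conComp ψ H (transition φ ψ y)) (covComp ψ h (transition φ ψ y)) =
      dot2 (conComp φ H y) (covComp φ h y) := by
  rw [conComp_transition hφ hψ H hy, dot2_conj, ← covComp_transition hφ hψ h hy]

/-- The contraction `H^{ab} h_{ab}` can be computed in any chart. -/
theorem pairing_eq (hφ : φ ∈ atlas (Coord n) M) (H : ConTensor n M) (h : CovTensor n M)
    {x : M} (hx : x ∈ φ.source) :
    pairing H h x = dot2 (conComp φ H (φ x)) (covComp φ h (φ x)) := by
  have hy : φ x ∈ overlap φ (chartAt (Coord n) x) :=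
    ⟨φ.map_source hx, by simp [φ.left_inv hx]⟩
  have h1 := dot2_comp_transition hφ (chart_mem_atlas (Coord n) x) H h hy
  rw [← h1, transition, φ.left_inv hx]
  rfl

theorem pairing_symm_eq (hφ : φ ∈ atlas (Coord n) M) (H : ConTensor n M) (h : CovTensor n M)
    (hy : y ∈ φ.target) :
    pairing H h (φ.symm y) = dot2 (conComp φ H y) (covComp φ h y) := by
  rw [pairing_eq hφ H h (φ.map_target hy), φ.right_inv hy]

theorem coframeVec_comp_frameVec (hφ : φ ∈ atlas (Coord n) M) (hy : y ∈ φ.target) :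
    (coframeVec φ (φ.symm y)).comp (frameVec φ y) = ContinuousLinearMap.id ℝ (Coord n) := by
  have := isManifold_one (n := n) (M := M)
  exact (mdifferentiable_of_mem_atlas (I := 𝓡 n) hφ).comp_symm_deriv hy

theorem frameVec_injective (hφ : φ ∈ atlas (Coord n) M) (hy : y ∈ φ.target) :
    Function.Injective (frameVec φ y) := by
  intro v w hvw
  have h := coframeVec_comp_frameVec hφ hy
  have hv := congrArg (fun L : Coord n →L[ℝ] Coord n => L v) h
  have hw := congrArg (fun L : Coord n →L[ℝ] Coord n => L w) h
  simp only [ContinuousLinearMap.comp_apply, ContinuousLinearMap.id_apply] at hv hw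
  rw [← hv, ← hw, hvw]

end Transition

/-! ### Components of metrics and of smooth families -/

section Families

variable {φ ψ : OpenPartialHomeomorph M (Coord n)} {y : Coord n} {T β : ℝ}

theorem covComp_transpose {h : CovTensor n M} (hs : ∀ x v w, h x v w = h x w v) (y : Coord n) :
    (covComp φ h y)ᵀ = covComp φ h y := by
  ext a b
  exact hs _ _ _

theorem conComp_transpose {H : ConTensor n M} (hs : ∀ x v w, H x v w = H x w v) (y : Coord n) :
    (conComp φ H y)ᵀ = conComp φ H y := by
  ext a b
  exact hs _ _ _

theorem SmoothCovFamily.smoothAt2 {h : ℝ → CovTensor n M} (hs : SmoothCovFamily h T)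
    (hφ : φ ∈ atlas (Coord n) M) (hβ : β ∈ Icc 0 T) (hy : y ∈ φ.target) :
    SmoothAt2 (covComp φ (h β)) y := by
  intro a b
  have h1 : ContDiffOn ℝ ∞ (fun z : Coord n => covComp φ (h β) z a b) φ.target :=
    (hs φ hφ a b).comp (f := fun z : Coord n => (β, z)) (contDiff_prodMk_right β).contDiffOn
      fun z hz => ⟨hβ, hz⟩
  exact h1.contDiffAt (φ.open_target.mem_nhds hy)

theorem SmoothConFamily.smoothAt2 {H : ℝ → ConTensor n M} (hs : SmoothConFamily H T)
    (hφ : φ ∈ atlas (Coord n) M) (hβ : β ∈ Icc 0 T) (hy : y ∈ φ.target) :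
    SmoothAt2 (conComp φ (H β)) y := by
  intro a b
  have h1 : ContDiffOn ℝ ∞ (fun z : Coord n => conComp φ (H β) z a b) φ.target :=
    (hs φ hφ a b).comp (f := fun z : Coord n => (β, z)) (contDiff_prodMk_right β).contDiffOn
      fun z hz => ⟨hβ, hz⟩
  exact h1.contDiffAt (φ.open_target.mem_nhds hy)

variable [IsManifold (𝓡 n) ∞ M]

/-- The component matrix is the Gram matrix of the coordinate frame, and the frame is linearly
independent because `frameVec` is injective. -/
theorem metComp_det_pos (hφ : φ ∈ atlas (Coord n) M) (g : Metric n M) (hy : y ∈ φ.target) :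
    0 < (metComp φ g y).det := by
  have h : (metComp φ g y).PosDef := by
    refine Matrix.PosDef.of_dotProduct_mulVec_pos ?_ fun x hx => ?_
    · ext a b
      exact g.symm _ _ _
    · set v : Coord n := ∑ a, x a • EuclideanSpace.single a (1 : ℝ) with hv
      have hvx : ∀ a, v a = x a := fun a => by simp [hv, Finset.sum_apply, Pi.single_apply]
      have hv0 : v ≠ 0 := by
        rintro h0
        refine hx (funext fun a => ?_)
        rw [← hvx, h0]
        rfl
      have hF : frameVec φ y v ≠ 0 := fun h0 =>
        hv0 (frameVec_injective hφ hy (by rw [h0, map_zero]))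
      have hp : 0 < covEval g.inner (φ.symm y) (frameVec φ y v) (frameVec φ y v) :=
        g.pos (φ.symm y) (frameVec φ y v) hF
      have hFv : frameVec φ y v = ∑ a, x a • frameVec φ y (EuclideanSpace.single a 1) := by
        simp only [hv, map_sum, map_smul]
      rw [hFv, bilin_sum] at hp
      have hq : star x ⬝ᵥ (metComp φ g y *ᵥ x) = ∑ a, ∑ b, x a * x b * metComp φ g y a b := by
        simp only [dotProduct, Matrix.mulVec, Finset.mul_sum, Pi.star_apply, star_trivial]
        exact Finset.sum_congr rfl fun a _ => Finset.sum_congr rfl fun b _ => by ring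
      rw [hq]
      exact hp
  exact h.det_pos

theorem isMetricAt_metComp {g : ℝ → Metric n M}
    (hs : SmoothCovFamily (fun β => (g β).inner) T) (hφ : φ ∈ atlas (Coord n) M)
    (hβ : β ∈ Icc 0 T) (hy : y ∈ φ.target) : IsMetricAt (metComp φ (g β)) y where
  smooth := hs.smoothAt2 hφ hβ hy
  symm := Eventually.of_forall fun z => covComp_transpose (fun x v w => (g β).symm x v w) z
  det_pos := metComp_det_pos hφ (g β) hy

end Families

end

/-! ### Integration by parts and differentiation under the integral on open sets of `ℝⁿ`. -/

section

variable {n : ℕ}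

/-! ### Integration in coordinates -/

section Integration

variable {U K : Set (Coord n)}

theorem integrableOn_of_continuousOn_of_eq_zero {f : Coord n → ℝ} (hU : MeasurableSet U)
    (hK : IsCompact K) (hKU : K ⊆ U) (hf : ContinuousOn f U) (h0 : ∀ y ∈ U \ K, f y = 0) :
    IntegrableOn f U :=
  ((hf.mono hKU).integrableOn_compact hK).of_forall_sdiff_eq_zero hU h0

/-- Integration by parts against the constant function `1`. -/
theorem integral_pd_eq_zero {f : Coord n → ℝ} (hf : ContDiff ℝ ∞ f) (hc : HasCompactSupport f)
    (k : Fin n) : ∫ y, pd k f y = 0 := by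
  have hcont : Continuous (pd k f) :=
    (hf.continuous_fderiv (by simp)).clm_apply continuous_const
  have hcs : HasCompactSupport (pd k f) := hc.fderiv_apply (𝕜 := ℝ) _
  have h := integral_mul_fderiv_eq_neg_fderiv_mul_of_integrable (𝕜 := ℝ) (μ := volume)
    (f := fun _ : Coord n => (1 : ℝ)) (g := f) (v := EuclideanSpace.single k (1 : ℝ))
    (by simp) (by simp only [one_mul]; exact hcont.integrable_of_hasCompactSupport hcs)
    (by simp only [one_mul]; exact hf.continuous.integrable_of_hasCompactSupport hc)
    (fun _ _ => differentiableAt_const _) (fun x _ => (hf.differentiable (by simp)) x)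
  simpa [pd] using h

/-- The function vanishes off a compact subset of `U`, so its extension by zero is smooth on all of
`ℝⁿ` with compact support. -/
theorem setIntegral_pd_eq_zero {f : Coord n → ℝ} (hU : IsOpen U) (hK : IsCompact K) (hKU : K ⊆ U)
    (hf : ∀ y ∈ U, ContDiffAt ℝ ∞ f y) (h0 : ∀ y ∈ U \ K, f y = 0) (k : Fin n) :
    ∫ y in U, pd k f y = 0 := by
  have hzero : ∀ y ∉ K, U.indicator f y = 0 := by
    intro y hy
    by_cases hyU : y ∈ U
    · rw [indicator_of_mem hyU, h0 y ⟨hyU, hy⟩]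
    · exact indicator_of_notMem hyU f
  have hloc : ∀ y ∉ K, U.indicator f =ᶠ[𝓝 y] fun _ => 0 := fun y hy => by
    filter_upwards [hK.isClosed.isOpen_compl.mem_nhds hy] with z hz using hzero z hz
  have hin : ∀ y ∈ U, U.indicator f =ᶠ[𝓝 y] f := fun y hy => by
    filter_upwards [hU.mem_nhds hy] with z hz using indicator_of_mem hz f
  have hsm : ContDiff ℝ ∞ (U.indicator f) := by
    rw [contDiff_iff_contDiffAt]
    intro y
    by_cases hy : y ∈ U
    · exact (hf y hy).congr_of_eventuallyEq (hin y hy)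
    · exact contDiffAt_const.congr_of_eventuallyEq (hloc y fun h => hy (hKU h))
  have hcs : HasCompactSupport (U.indicator f) :=
    HasCompactSupport.intro hK fun y hy => hzero y hy
  rw [← integral_pd_eq_zero hsm hcs k, ← integral_indicator hU.measurableSet]
  congr 1
  ext y
  by_cases hy : y ∈ U
  · rw [indicator_of_mem hy, pd_congr (hin y hy)]
  · rw [indicator_of_notMem hy, pd_congr (hloc y fun h => hy (hKU h)), pd_const]

/-- Integration by parts against a compactly supported function. -/
theorem setIntegral_mul_sum_pd {χ : Coord n → ℝ} {F : Fin n → Coord n → ℝ} (hU : IsOpen U)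
    (hK : IsCompact K) (hKU : K ⊆ U) (hχ : ∀ y ∈ U, ContDiffAt ℝ ∞ χ y)
    (h0 : ∀ y ∈ U \ K, χ y = 0) (hF : ∀ k, ∀ y ∈ U, ContDiffAt ℝ ∞ (F k) y) :
    ∫ y in U, χ y * ∑ k, pd k (F k) y = -∫ y in U, ∑ k, F k y * pd k χ y := by
  have hpd0 : ∀ k, ∀ y ∈ U \ K, pd k χ y = 0 := by
    intro k y hy
    have h1 : χ =ᶠ[𝓝 y] fun _ => 0 := by
      filter_upwards [(hU.sdiff hK.isClosed).mem_nhds hy] with z hz using h0 z hz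
    rw [pd_congr h1, pd_const]
  have hint1 : ∀ k, IntegrableOn (fun y => χ y * pd k (F k) y) U := fun k =>
    integrableOn_of_continuousOn_of_eq_zero hU.measurableSet hK hKU
      (fun y hy => ((hχ y hy).mul (contDiffAt_pd (hF k y hy))).continuousAt.continuousWithinAt)
      fun y hy => by rw [h0 y hy, zero_mul]
  have hint2 : ∀ k, IntegrableOn (fun y => F k y * pd k χ y) U := fun k =>
    integrableOn_of_continuousOn_of_eq_zero hU.measurableSet hK hKU
      (fun y hy => ((hF k y hy).mul (contDiffAt_pd (hχ y hy))).continuousAt.continuousWithinAt)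
      fun y hy => by rw [hpd0 k y hy, mul_zero]
  simp only [Finset.mul_sum]
  rw [integral_finsetSum _ fun k _ => hint1 k, integral_finsetSum _ fun k _ => hint2 k,
    ← Finset.sum_neg_distrib]
  refine Finset.sum_congr rfl fun k _ => ?_
  rw [eq_neg_iff_add_eq_zero, ← integral_add (hint1 k) (hint2 k),
    ← setIntegral_pd_eq_zero hU hK hKU (f := fun y => χ y * F k y)
      (fun y hy => (hχ y hy).mul (hF k y hy)) (fun y hy => by rw [h0 y hy, zero_mul]) k]
  refine setIntegral_congr_fun hU.measurableSet fun y hy => ?_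
  rw [pd_mul ((hχ y hy).differentiableAt (by simp)) ((hF k y hy).differentiableAt (by simp))]
  ring

/-- Differentiation under the integral sign, with one-sided derivatives at the ends of the
interval. -/
theorem hasDerivWithinAt_setIntegral {T : ℝ} (hT : 0 < T) {f f' : ℝ → Coord n → ℝ}
    (hU : IsOpen U) (hK : IsCompact K) (hKU : K ⊆ U)
    (hf : ContDiffOn ℝ ∞ (fun p : ℝ × Coord n => f p.1 p.2) (Icc 0 T ×ˢ U))
    (hd : ∀ t ∈ Icc 0 T, ∀ y ∈ U, HasDerivWithinAt (fun s => f s y) (f' t y) (Icc 0 T) t)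
    (h0 : ∀ t ∈ Icc 0 T, ∀ y ∈ U \ K, f t y = 0) (h0' : ∀ t ∈ Icc 0 T, ∀ y ∈ U \ K, f' t y = 0)
    {t : ℝ} (ht : t ∈ Icc 0 T) :
    HasDerivWithinAt (fun s => ∫ y in U, f s y) (∫ y in U, f' t y) (Icc 0 T) t := by
  have hUD : UniqueDiffOn ℝ (Icc 0 T ×ˢ U) := (uniqueDiffOn_Icc hT).prod hU.uniqueDiffOn
  -- The pointwise time derivative is a directional derivative of a jointly smooth function, hence
  -- jointly continuous and bounded on the compact set `[0, T] × K`.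
  have hfd : ∀ s ∈ Icc 0 T, ∀ y ∈ U, f' s y =
      fderivWithin ℝ (fun p : ℝ × Coord n => f p.1 p.2) (Icc 0 T ×ˢ U) (s, y) (1, 0) := by
    intro s hs y hy
    have h1 := ((hf (s, y) ⟨hs, hy⟩).differentiableWithinAt (by simp)).hasFDerivWithinAt
    have h2 : HasDerivWithinAt (fun r : ℝ => (r, y)) (1, 0) (Icc 0 T) s :=
      (hasDerivWithinAt_id s _).prodMk (hasDerivWithinAt_const s _ y)
    have hm : MapsTo (fun r : ℝ => (r, y)) (Icc 0 T) (Icc 0 T ×ˢ U) := fun r hr => ⟨hr, hy⟩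
    have h3 := h1.comp_hasDerivWithinAt s h2 hm
    exact (uniqueDiffOn_Icc hT s hs).eq_deriv _ (hd s hs y hy) h3
  have hf'c : ContinuousOn (fun p : ℝ × Coord n => f' p.1 p.2) (Icc 0 T ×ˢ U) :=
    ((hf.continuousOn_fderivWithin hUD (by simp)).clm_apply continuousOn_const).congr
      fun p hp => hfd p.1 hp.1 p.2 hp.2
  obtain ⟨C, hC⟩ := (isCompact_Icc.prod hK).exists_bound_of_continuousOn
    (hf'c.mono (prod_mono_right hKU))
  have hslice : ∀ s ∈ Icc 0 T, ContinuousOn (f s) K := fun s hs =>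
    hf.continuousOn.comp (f := fun y => (s, y)) (by fun_prop) fun y hy => ⟨hs, hKU hy⟩
  have hint : ∀ s ∈ Icc 0 T, IntegrableOn (f s) K := fun s hs =>
    (hslice s hs).integrableOn_compact hK
  have hred : ∀ s ∈ Icc 0 T, ∫ y in U, f s y = ∫ y in K, f s y := fun s hs =>
    (setIntegral_eq_of_subset_of_forall_sdiff_eq_zero hU.measurableSet hKU (h0 s hs))
  have hred' : ∫ y in U, f' t y = ∫ y in K, f' t y :=
    setIntegral_eq_of_subset_of_forall_sdiff_eq_zero hU.measurableSet hKU (h0' t ht)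
  rw [hred']
  refine HasDerivWithinAt.congr ?_ hred (hred t ht)
  rw [hasDerivWithinAt_iff_tendsto_slope]
  have hmem : ∀ᶠ s in 𝓝[Icc 0 T \ {t}] t, s ∈ Icc 0 T \ {t} := self_mem_nhdsWithin
  have hlim : Tendsto (fun s => ∫ y in K, slope (fun r => f r y) t s) (𝓝[Icc 0 T \ {t}] t)
      (𝓝 (∫ y in K, f' t y)) := by
    refine tendsto_integral_filter_of_dominated_convergence (fun _ => C) ?_ ?_ ?_ ?_
    · filter_upwards [hmem] with s hs
      have : IntegrableOn (fun y => (s - t)⁻¹ • (f s y - f t y)) K :=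
        ((hint s hs.1).sub (hint t ht)).smul (s - t)⁻¹
      simpa only [slope, vsub_eq_sub] using this.aestronglyMeasurable
    · filter_upwards [hmem] with s hs
      filter_upwards [ae_restrict_mem hK.measurableSet] with y hy
      -- The mean value inequality bounds all difference quotients by `C`, the dominating constant.
      have h1 := (convex_Icc (0 : ℝ) T).norm_image_sub_le_of_norm_hasDerivWithin_le
        (f := fun r => f r y) (f' := fun r => f' r y) (C := C)
        (fun r hr => hd r hr y (hKU hy)) (fun r hr => hC (r, y) ⟨hr, hy⟩) ht hs.1
      have h2 : 0 < ‖s - t‖ := norm_pos_iff.mpr (sub_ne_zero.mpr hs.2)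
      rw [slope, vsub_eq_sub, norm_smul, norm_inv, inv_mul_le_iff₀ h2, mul_comm]
      exact h1
    · exact integrableOn_const hK.measure_lt_top.ne
    · filter_upwards [ae_restrict_mem hK.measurableSet] with y hy
      exact hasDerivWithinAt_iff_tendsto_slope.mp (hd t ht y (hKU hy))
  refine hlim.congr' ?_
  filter_upwards [hmem] with s hs
  simp only [slope, vsub_eq_sub]
  rw [integral_smul, integral_sub (hint s hs.1) (hint t ht)]

end Integration

end

/-! ### The Riemannian measure in coordinates -/

section Measure

variable {n : ℕ} {M : Type*} [TopologicalSpace M] [ChartedSpace (Coord n) M]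
  [IsManifold (𝓡 n) ∞ M]

/-- The defining chart varies with the point; near `x` chart independence allows the chart at `x` to
be kept fixed. -/
theorem continuous_pairing {H : ConTensor n M} {h : CovTensor n M}
    (hH : ∀ φ ∈ atlas (Coord n) M, ∀ y ∈ φ.target, SmoothAt2 (conComp φ H) y)
    (hh : ∀ φ ∈ atlas (Coord n) M, ∀ y ∈ φ.target, SmoothAt2 (covComp φ h) y) :
    Continuous (pairing H h) := by
  rw [continuous_iff_continuousAt]
  intro x
  have hφ := chart_mem_atlas (Coord n) x
  set φ := chartAt (Coord n) x
  have hx : x ∈ φ.source := mem_chart_source _ x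
  have h1 : pairing H h =ᶠ[𝓝 x] fun z => dot2 (conComp φ H (φ z)) (covComp φ h (φ z)) := by
    filter_upwards [φ.open_source.mem_nhds hx] with z hz using pairing_eq hφ H h hz
  refine ContinuousAt.congr ?_ h1.symm
  have h2 := (contDiffAt_dot2 (hH φ hφ _ (φ.map_source hx))
    (hh φ hφ _ (φ.map_source hx))).continuousAt
  exact h2.comp (f := φ) (φ.continuousAt hx)

variable [T2Space M] [CompactSpace M]

variable (n M) in
/-- The function `ρ_p` of the partition of unity in the preferred chart at `q`. -/
def cutoff (p q : M) (y : Coord n) : ℝ := chartPartition n M p ((chartAt (Coord n) q).symm y)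

variable (n M) in
theorem finite_chartPartition :
    {p : M | (Function.support (chartPartition n M p)).Nonempty}.Finite :=
  (chartPartition n M).locallyFinite.finite_nonempty_of_compact

variable (n M) in
/-- The indices of the functions of the partition of unity that are not identically zero. -/
def chartIndex : Finset M := (finite_chartPartition n M).toFinset

theorem chartPartition_eq_zero {p : M} (hp : p ∉ chartIndex n M) (x : M) :
    chartPartition n M p x = 0 := by
  by_contra hx
  exact hp ((finite_chartPartition n M).mem_toFinset.mpr ⟨x, hx⟩)

theorem sum_chartPartition (x : M) : ∑ p ∈ chartIndex n M, chartPartition n M p x = 1 := by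
  rw [← (chartPartition n M).sum_eq_one (mem_univ x)]
  refine (finsum_eq_sum_of_support_subset _ fun p hp => ?_).symm
  by_contra h
  exact hp (chartPartition_eq_zero h x)

theorem sum_cutoff (q : M) (y : Coord n) : ∑ p ∈ chartIndex n M, cutoff n M p q y = 1 :=
  sum_chartPartition _

theorem contDiffAt_cutoff (p : M) {q : M} {y : Coord n}
    (hy : y ∈ (chartAt (Coord n) q).target) : ContDiffAt ℝ ∞ (cutoff n M p q) y := by
  have h1 : ContMDiffAt (𝓡 n) (𝓡 n) ∞ (chartAt (Coord n) q).symm y :=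
    contMDiffAt_symm_of_mem_maximalAtlas
      (IsManifold.subset_maximalAtlas (chart_mem_atlas _ q)) hy
  have h2 : ContMDiffAt (𝓡 n) 𝓘(ℝ, ℝ) ∞ (chartPartition n M p) ((chartAt (Coord n) q).symm y) :=
    (chartPartition n M p).contMDiff.contMDiffAt
  exact contMDiffAt_iff_contDiffAt.mp (h2.comp y h1)

variable (n M) in
/-- The support of `ρ_p`, in the preferred chart at `p`. -/
def cutoffSupport (p : M) : Set (Coord n) :=
  chartAt (Coord n) p '' tsupport (chartPartition n M p)

theorem isCompact_cutoffSupport (p : M) : IsCompact (cutoffSupport n M p) :=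
  (isClosed_tsupport _).isCompact.image_of_continuousOn
    ((chartAt (Coord n) p).continuousOn.mono (chartPartition_isSubordinate n M p))

theorem cutoffSupport_subset (p : M) : cutoffSupport n M p ⊆ (chartAt (Coord n) p).target := by
  rintro _ ⟨x, hx, rfl⟩
  exact (chartAt (Coord n) p).map_source (chartPartition_isSubordinate n M p hx)

theorem cutoff_eq_zero {p : M} {y : Coord n}
    (hy : y ∈ (chartAt (Coord n) p).target \ cutoffSupport n M p) : cutoff n M p p y = 0 := by
  by_contra h
  exact hy.2 ⟨_, subset_tsupport _ h, (chartAt (Coord n) p).right_inv hy.1⟩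

/-- Vanishing near `y`, not merely at `y`, makes the derivatives of the cutoff vanish as well. -/
theorem cutoff_eventuallyEq_zero {p q : M} {y : Coord n}
    (hy : y ∈ (chartAt (Coord n) q).target \
      overlap (chartAt (Coord n) q) (chartAt (Coord n) p)) :
    cutoff n M p q =ᶠ[𝓝 y] fun _ => 0 := by
  have h1 : (chartAt (Coord n) q).symm y ∉ tsupport (chartPartition n M p) := fun h =>
    hy.2 ⟨hy.1, chartPartition_isSubordinate n M p h⟩
  have h2 := ((chartAt (Coord n) q).continuousAt_symm hy.1).eventually
    ((isClosed_tsupport _).isOpen_compl.mem_nhds h1)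
  filter_upwards [h2] with z hz
  exact (image_eq_zero_of_notMem_tsupport hz : chartPartition n M p _ = 0)

variable [MeasurableSpace M] [BorelSpace M]

theorem riemannianMeasure_eq_sum (g : Metric n M) :
    riemannianMeasure g = ∑ p ∈ chartIndex n M,
      (chartVolume g (chartAt (Coord n) p)).withDensity
        fun x => ENNReal.ofReal (chartPartition n M p x) := by
  ext s hs
  rw [riemannianMeasure, Measure.sum_apply _ hs, Measure.finsetSum_apply]
  refine tsum_eq_sum fun p hp => ?_
  simp [chartPartition_eq_zero hp]

/-- Integrability comes from the compact support of `ρ_p` inside the chart, so the behaviour of `√g`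
near the edge of the chart plays no role. -/
theorem integral_chartVolume {g : Metric n M}
    (hG : ∀ φ ∈ atlas (Coord n) M, ∀ y ∈ φ.target, IsMetricAt (metComp φ g) y)
    {f : M → ℝ} (hf : Continuous f) (p : M) :
    let ν := (chartVolume g (chartAt (Coord n) p)).withDensity
      fun x => ENNReal.ofReal (chartPartition n M p x)
    Integrable f ν ∧ ∫ x, f x ∂ν = ∫ y in (chartAt (Coord n) p).target, cutoff n M p p y *
      (Real.sqrt (metComp (chartAt (Coord n) p) g y).det * f ((chartAt (Coord n) p).symm y)) := by
  intro ν
  set φ := chartAt (Coord n) p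
  have hφ : φ ∈ atlas (Coord n) M := chart_mem_atlas _ p
  have hφm : MeasurableSet φ.target := φ.open_target.measurableSet
  set d : Coord n → NNReal := fun y => (Real.sqrt (metComp φ g y).det).toNNReal with hd
  set r : M → NNReal := fun x => (chartPartition n M p x).toNNReal with hr
  have hsq : ContinuousOn (fun y => Real.sqrt (metComp φ g y).det) φ.target := fun y hy =>
    (hG φ hφ y hy).smooth.det.continuousAt.sqrt.continuousWithinAt
  have hdm : AEMeasurable d (volume.restrict φ.target) :=
    (hsq.aemeasurable hφm).real_toNNReal
  have hρ : Continuous (chartPartition n M p) := (chartPartition n M p).contMDiff.continuous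
  have hrm : Measurable r := hρ.measurable.real_toNNReal
  have hsm0 : AEMeasurable φ.symm (volume.restrict φ.target) :=
    φ.continuousOn_symm.aemeasurable hφm
  have hsm : AEMeasurable φ.symm ((volume.restrict φ.target).withDensity fun y => (d y : ENNReal)) :=
    hsm0.mono_ac (withDensity_absolutelyContinuous _ _)
  -- `ENNReal.ofReal` is by definition the coercion of `Real.toNNReal`, the form wanted by the
  -- `withDensity` lemmas.
  have hν : ν = (Measure.map φ.symm ((volume.restrict φ.target).withDensity
      fun y => (d y : ENNReal))).withDensity fun x => (r x : ENNReal) := rfl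
  have hrf : AEStronglyMeasurable (fun x => r x • f x) (Measure.map φ.symm
      ((volume.restrict φ.target).withDensity fun y => (d y : ENNReal))) :=
    (hrm.smul hf.measurable).aestronglyMeasurable
  have hfun : ∀ y, d y • r (φ.symm y) • f (φ.symm y) = cutoff n M p p y *
      (Real.sqrt (metComp φ g y).det * f (φ.symm y)) := by
    intro y
    simp only [NNReal.smul_def, hd, hr, Real.coe_toNNReal _ (Real.sqrt_nonneg _),
      Real.coe_toNNReal _ ((chartPartition n M).nonneg p _), smul_eq_mul, cutoff]
    ring
  constructor
  · rw [hν, integrable_withDensity_iff_integrable_smul₀ hrm.aemeasurable,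
      integrable_map_measure hrf hsm, integrable_withDensity_iff_integrable_smul₀ hdm]
    simp only [Function.comp_apply, hfun]
    refine integrableOn_of_continuousOn_of_eq_zero hφm (isCompact_cutoffSupport p)
      (cutoffSupport_subset p) ?_ fun y hy => by rw [cutoff_eq_zero hy, zero_mul]
    have hc : ContinuousOn (cutoff n M p p) φ.target := fun y hy =>
      (contDiffAt_cutoff p hy).continuousAt.continuousWithinAt
    exact hc.mul (hsq.mul (hf.comp_continuousOn φ.continuousOn_symm))
  · rw [hν, integral_withDensity_eq_integral_smul₀ hrm.aemeasurable, integral_map hsm hrf,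
      integral_withDensity_eq_integral_smul₀ hdm]
    simp only [hfun]

theorem integral_riemannianMeasure {g : Metric n M}
    (hG : ∀ φ ∈ atlas (Coord n) M, ∀ y ∈ φ.target, IsMetricAt (metComp φ g) y)
    {f : M → ℝ} (hf : Continuous f) :
    ∫ x, f x ∂(riemannianMeasure g) = ∑ p ∈ chartIndex n M,
      ∫ y in (chartAt (Coord n) p).target, cutoff n M p p y *
        (Real.sqrt (metComp (chartAt (Coord n) p) g y).det *
          f ((chartAt (Coord n) p).symm y)) := by
  rw [riemannianMeasure_eq_sum,
    integral_finsetSum_measure fun p _ => (integral_chartVolume hG hf p).1]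
  exact Finset.sum_congr rfl fun p _ => (integral_chartVolume hG hf p).2

end Measure

/-! ### The divergence theorem on the closed manifold -/

section Divergence

variable {n : ℕ} {M : Type*} [TopologicalSpace M] [ChartedSpace (Coord n) M]
  [IsManifold (𝓡 n) ∞ M] [T2Space M] [CompactSpace M]

/-- The flux density of the metric `g` and the tensors `H` and `h` in the preferred chart at `q`. -/
def chartFlux (g : Metric n M) (H : ConTensor n M) (h : CovTensor n M) (q : M) (k : Fin n)
    (y : Coord n) : ℝ :=
  flux (metComp (chartAt (Coord n) q) g) (conComp (chartAt (Coord n) q) H)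
    (covComp (chartAt (Coord n) q) h) k y

/-- The flux density paired with `dρ_p`, in the preferred chart at `q`. -/
def chartFluxPd (g : Metric n M) (H : ConTensor n M) (h : CovTensor n M) (p q : M)
    (y : Coord n) : ℝ :=
  ∑ k, chartFlux g H h q k y * pd k (cutoff n M p q) y

variable {g : Metric n M} {H : ConTensor n M} {h : CovTensor n M}
  (hG : ∀ φ ∈ atlas (Coord n) M, ∀ y ∈ φ.target, IsMetricAt (metComp φ g) y)
  (hH : ∀ φ ∈ atlas (Coord n) M, ∀ y ∈ φ.target, SmoothAt2 (conComp φ H) y)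
  (hh : ∀ φ ∈ atlas (Coord n) M, ∀ y ∈ φ.target, SmoothAt2 (covComp φ h) y)

include hG hH hh

theorem contDiffAt_chartFlux {q : M} {y : Coord n} (hy : y ∈ (chartAt (Coord n) q).target)
    (k : Fin n) : ContDiffAt ℝ ∞ (chartFlux g H h q k) y :=
  have hφ := chart_mem_atlas (Coord n) q
  contDiffAt_flux (hG _ hφ y hy) (hH _ hφ y hy) (hh _ hφ y hy) k

theorem contDiffAt_chartFluxPd (p : M) {q : M} {y : Coord n}
    (hy : y ∈ (chartAt (Coord n) q).target) : ContDiffAt ℝ ∞ (chartFluxPd g H h p q) y :=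
  ContDiffAt.sum fun k _ => (contDiffAt_chartFlux hG hH hh hy k).mul
    (contDiffAt_pd (contDiffAt_cutoff p hy))

theorem chartFluxPd_transition (p : M) {q r : M} {y : Coord n}
    (hy : y ∈ overlap (chartAt (Coord n) q) (chartAt (Coord n) r)) :
    chartFluxPd g H h p q y =
      |(fderiv ℝ (transition (chartAt (Coord n) q) (chartAt (Coord n) r)) y).det| *
        chartFluxPd g H h p r (transition (chartAt (Coord n) q) (chartAt (Coord n) r) y) := by
  have hq := chart_mem_atlas (Coord n) q
  have hr := chart_mem_atlas (Coord n) r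
  have hτ := contDiffAt_transition hq hr hy
  have hy' := (transition_mem_overlap hy).1
  have hev := (isOpen_overlap (chartAt (Coord n) q) (chartAt (Coord n) r)).mem_nhds hy
  rw [det_fderiv (hτ.differentiableAt (by simp))]
  exact sum_flux_mul_pd_transform hτ (hG _ hq y hy.1) (hG _ hr _ hy')
    (by filter_upwards [hev] with z hz using covComp_transition hq hr g.inner hz)
    (hh _ hr _ hy')
    (by filter_upwards [hev] with z hz using covComp_transition hq hr h hz)
    (hH _ hq y hy.1) (hH _ hr _ hy')
    (by filter_upwards [hev] with z hz using conComp_transition hq hr H hz)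
    ((contDiffAt_cutoff p hy').differentiableAt (by simp))
    (by filter_upwards [hev] with z hz using by simp only [cutoff, symm_transition hz])

/-- Both integrands live on the overlap of the two charts: in the chart at `p` because of `ρ_q`, in
the chart at `q` because of `dρ_p`. There the density law is the change of variables formula. -/
theorem setIntegral_cutoff_mul_chartFluxPd (p q : M) :
    ∫ y in (chartAt (Coord n) p).target, cutoff n M q p y * chartFluxPd g H h p p y =
      ∫ y in (chartAt (Coord n) q).target, cutoff n M q q y * chartFluxPd g H h p q y := by
  set φ := chartAt (Coord n) p with hφdef
  set ψ := chartAt (Coord n) q with hψdef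
  have hφ : φ ∈ atlas (Coord n) M := chart_mem_atlas (Coord n) p
  have hψ : ψ ∈ atlas (Coord n) M := chart_mem_atlas (Coord n) q
  have hm := (isOpen_overlap φ ψ).measurableSet
  have e1 : ∫ y in φ.target, cutoff n M q p y * chartFluxPd g H h p p y =
      ∫ y in overlap φ ψ, cutoff n M q p y * chartFluxPd g H h p p y := by
    refine setIntegral_eq_of_subset_of_forall_sdiff_eq_zero φ.open_target.measurableSet
      inter_subset_left fun y hy => ?_
    rw [(cutoff_eventuallyEq_zero hy).self_of_nhds, zero_mul]
  have e2 : ∫ y in ψ.target, cutoff n M q q y * chartFluxPd g H h p q y =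
      ∫ y in overlap ψ φ, cutoff n M q q y * chartFluxPd g H h p q y := by
    refine setIntegral_eq_of_subset_of_forall_sdiff_eq_zero ψ.open_target.measurableSet
      inter_subset_left fun y hy => ?_
    have : chartFluxPd g H h p q y = 0 := by
      refine Finset.sum_eq_zero fun k _ => ?_
      rw [pd_congr (cutoff_eventuallyEq_zero hy), pd_const, mul_zero]
    rw [this, mul_zero]
  rw [e1, e2, ← image_transition (φ := φ) (ψ := ψ),
    integral_image_eq_integral_abs_det_fderiv_smul volume hm
      (fun y hy => ((contDiffAt_transition hφ hψ hy).differentiableAt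
        (by simp)).hasFDerivAt.hasFDerivWithinAt) injOn_transition]
  refine setIntegral_congr_fun hm fun y hy => ?_
  have h1 := chartFluxPd_transition hG hH hh p hy
  have h2 : cutoff n M q q (transition φ ψ y) = cutoff n M q p y := by
    simp only [cutoff]
    exact congrArg _ (symm_transition hy)
  simp only [h2, smul_eq_mul]
  rw [h1]
  ring

/-- The integral over the closed manifold of the divergence of the flux vanishes. -/
theorem sum_setIntegral_cutoff_mul_divergence :
    ∑ p ∈ chartIndex n M, ∫ y in (chartAt (Coord n) p).target,
      cutoff n M p p y * ∑ k, pd k (chartFlux g H h p k) y = 0 := by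
  have hO : ∀ p : M, MeasurableSet (chartAt (Coord n) p).target := fun p =>
    (chartAt (Coord n) p).open_target.measurableSet
  have h1 : ∀ p : M, ∫ y in (chartAt (Coord n) p).target,
      cutoff n M p p y * ∑ k, pd k (chartFlux g H h p k) y =
      -∫ y in (chartAt (Coord n) p).target, chartFluxPd g H h p p y := fun p =>
    setIntegral_mul_sum_pd (chartAt (Coord n) p).open_target (isCompact_cutoffSupport p)
      (cutoffSupport_subset p) (fun y hy => contDiffAt_cutoff p hy) (fun y hy => cutoff_eq_zero hy)
      fun k y hy => contDiffAt_chartFlux hG hH hh hy k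
  -- Insert `1 = ∑_q ρ_q` and carry each piece to the chart at `q`.
  have h2 : ∀ p : M, ∫ y in (chartAt (Coord n) p).target, chartFluxPd g H h p p y =
      ∑ q ∈ chartIndex n M, ∫ y in (chartAt (Coord n) q).target,
        cutoff n M q q y * chartFluxPd g H h p q y := by
    intro p
    have hint : ∀ q ∈ chartIndex n M, IntegrableOn
        (fun y => cutoff n M q p y * chartFluxPd g H h p p y) (chartAt (Coord n) p).target := by
      intro q _
      refine integrableOn_of_continuousOn_of_eq_zero (hO p) (isCompact_cutoffSupport p)
        (cutoffSupport_subset p) (fun y hy => ((contDiffAt_cutoff q hy).mul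
          (contDiffAt_chartFluxPd hG hH hh p hy)).continuousAt.continuousWithinAt) fun y hy => ?_
      have h3 : cutoff n M p p =ᶠ[𝓝 y] fun _ => 0 := by
        filter_upwards [((chartAt (Coord n) p).open_target.sdiff
          (isCompact_cutoffSupport p).isClosed).mem_nhds hy] with z hz using cutoff_eq_zero hz
      have h4 : chartFluxPd g H h p p y = 0 := by
        refine Finset.sum_eq_zero fun k _ => ?_
        rw [pd_congr h3, pd_const, mul_zero]
      rw [h4, mul_zero]
    rw [← Finset.sum_congr rfl fun q _ => setIntegral_cutoff_mul_chartFluxPd hG hH hh p q,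
      ← integral_finsetSum _ hint]
    simp only [← Finset.sum_mul, sum_cutoff, one_mul]
  -- In the single chart at `q` the sum over `p` falls on `∑_p dρ_p = d1 = 0`.
  have h5 : ∀ q : M, ∑ p ∈ chartIndex n M, ∫ y in (chartAt (Coord n) q).target,
      cutoff n M q q y * chartFluxPd g H h p q y = 0 := by
    intro q
    rw [← integral_finsetSum]
    · rw [← integral_zero (Coord n) ℝ (μ := volume.restrict (chartAt (Coord n) q).target)]
      refine setIntegral_congr_fun (hO q) fun y hy => ?_
      have h6 : ∀ k, ∑ p ∈ chartIndex n M, pd k (cutoff n M p q) y = 0 := by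
        intro k
        rw [← pd_sum fun p _ => (contDiffAt_cutoff p hy).differentiableAt (by simp)]
        simp only [sum_cutoff, pd_const]
      simp only [← Finset.mul_sum, chartFluxPd]
      rw [Finset.sum_comm]
      simp only [← Finset.mul_sum, h6, mul_zero, Finset.sum_const_zero]
    · intro p _
      exact integrableOn_of_continuousOn_of_eq_zero (hO q) (isCompact_cutoffSupport q)
        (cutoffSupport_subset q) (fun y hy => ((contDiffAt_cutoff q hy).mul
          (contDiffAt_chartFluxPd hG hH hh p hy)).continuousAt.continuousWithinAt)
        fun y hy => by rw [cutoff_eq_zero hy, zero_mul]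
  simp only [h1, Finset.sum_neg_distrib, h2]
  rw [Finset.sum_comm, Finset.sum_congr rfl fun q _ => h5 q, Finset.sum_const_zero, neg_zero]

end Divergence

/-! ### Time derivatives -/

section TimeDerivative

variable {n : ℕ} {s : Set ℝ} {t : ℝ}

theorem hasDerivWithinAt_dot2 {A B : ℝ → Matrix (Fin n) (Fin n) ℝ}
    {A' B' : Matrix (Fin n) (Fin n) ℝ}
    (hA : ∀ a b, HasDerivWithinAt (fun τ => A τ a b) (A' a b) s t)
    (hB : ∀ a b, HasDerivWithinAt (fun τ => B τ a b) (B' a b) s t) :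
    HasDerivWithinAt (fun τ => dot2 (A τ) (B τ)) (dot2 A' (B t) + dot2 (A t) B') s t := by
  simp only [dot2, ← Finset.sum_add_distrib]
  exact HasDerivWithinAt.fun_sum fun a _ => HasDerivWithinAt.fun_sum fun b _ =>
    (hA a b).mul (hB a b)

theorem hasDerivWithinAt_sqrt_det {A : ℝ → Matrix (Fin n) (Fin n) ℝ}
    {A' : Matrix (Fin n) (Fin n) ℝ} (hd : 0 < (A t).det)
    (hA : ∀ a b, HasDerivWithinAt (fun τ => A τ a b) (A' a b) s t) :
    HasDerivWithinAt (fun τ => Real.sqrt (A τ).det)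
      (1 / 2 * Real.sqrt (A t).det * ((A t)⁻¹ * A').trace) s t := by
  have h1 := (hasFDerivWithinAt_det fun a b => (hA a b).hasFDerivWithinAt).hasDerivWithinAt
  have h2 := h1.sqrt hd.ne'
  convert h2 using 1
  have h3 := Real.mul_self_sqrt hd.le
  have h4 := (Real.sqrt_pos.mpr hd).ne'
  have h5 : ((A t)⁻¹ * A').trace = (A t).det⁻¹ * ∑ a, ∑ b, (A t).adjugate b a * A' a b := by
    rw [Matrix.inv_def, Ring.inverse_eq_inv', Matrix.smul_mul, Matrix.trace_smul, smul_eq_mul]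
    simp only [Matrix.trace, Matrix.diag_apply, Matrix.mul_apply]
    rw [Finset.sum_comm]
  rw [h5]
  simp only [sum_apply, smul_apply, smul_eq_mul, ContinuousLinearMap.toSpanSingleton_apply,
    one_mul]
  field_simp
  rw [sq, h3, mul_comm]

theorem hasDerivWithinAt_comp_const_sub {T : ℝ} {f : ℝ → ℝ} {f' : ℝ}
    (hf : HasDerivWithinAt f f' (Icc 0 T) (T - t)) :
    HasDerivWithinAt (fun τ => f (T - τ)) (-f') (Icc 0 T) t := by
  have h1 : HasDerivWithinAt (fun τ => T - τ) (-1) (Icc 0 T) t :=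
    (hasDerivWithinAt_id t _).const_sub T
  have h2 : MapsTo (fun τ => T - τ) (Icc 0 T) (Icc 0 T) := fun τ hτ =>
    ⟨sub_nonneg.mpr hτ.2, sub_le_self _ hτ.1⟩
  have h3 := hf.scomp t h1 h2
  rw [neg_one_smul] at h3
  exact h3

end TimeDerivative

section Flow

variable {n : ℕ} {M : Type*} [TopologicalSpace M] [ChartedSpace (Coord n) M]
  [IsManifold (𝓡 n) ∞ M] {T : ℝ} {g : ℝ → Metric n M} {H : ℝ → ConTensor n M}
  {h : ℝ → CovTensor n M}

theorem const_sub_mem_Icc {t : ℝ} (ht : t ∈ Icc 0 T) : T - t ∈ Icc 0 T :=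
  ⟨sub_nonneg.mpr ht.2, sub_le_self _ ht.1⟩

/-- Along a Ricci flow the Ricci tensor is symmetric, being a time derivative of the metric. -/
theorem IsRicciFlow.ricci_symm (hg : IsRicciFlow g T) (hT : 0 < T)
    {φ : OpenPartialHomeomorph M (Coord n)} (hφ : φ ∈ atlas (Coord n) M) {β : ℝ}
    (hβ : β ∈ Icc 0 T) {y : Coord n} (hy : y ∈ φ.target) (a b : Fin n) :
    ricci (metComp φ (g β)) y a b = ricci (metComp φ (g β)) y b a := by
  have h1 := hg.flow φ hφ β hβ y hy a b
  have h2 := hg.flow φ hφ β hβ y hy b a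
  have h3 : (fun τ => metComp φ (g τ) y b a) = fun τ => metComp φ (g τ) y a b :=
    funext fun τ => (g τ).symm _ _ _
  rw [h3] at h2
  -- Derivatives within `[0, T]` are unique only for a nondegenerate interval, which is the role of
  -- `hT`.
  linarith [(uniqueDiffOn_Icc hT β hβ).eq_deriv _ h1 h2]

/-- The density `√g H^{ab} h_{ab}` in the chart `φ`, at time `η` of the backward flow. -/
def pairingDensity (g : ℝ → Metric n M) (H : ℝ → ConTensor n M) (h : ℝ → CovTensor n M) (T : ℝ)
    (φ : OpenPartialHomeomorph M (Coord n)) (η : ℝ) (y : Coord n) : ℝ :=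
  Real.sqrt (metComp φ (g (T - η)) y).det *
    dot2 (conComp φ (H η) y) (covComp φ (h (T - η)) y)

/-- The growth `R √g` of the volume density cancels `-R H`; Green's identity turns the remainder
into a divergence. -/
theorem hasDerivWithinAt_pairingDensity (hT : 0 < T) (hg : IsRicciFlow g T)
    (hH : IsConjugateLinearizedFlow (fun η => g (T - η)) H T)
    (hh : IsReducedLinearizedFlow g h T) {φ : OpenPartialHomeomorph M (Coord n)}
    (hφ : φ ∈ atlas (Coord n) M) {η : ℝ} (hη : η ∈ Icc 0 T) {y : Coord n} (hy : y ∈ φ.target) :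
    HasDerivWithinAt (fun τ => pairingDensity g H h T φ τ y)
      (∑ k, pd k (flux (metComp φ (g (T - η))) (conComp φ (H η)) (covComp φ (h (T - η))) k) y)
      (Icc 0 T) η := by
  have hβ := const_sub_mem_Icc hη
  have hG := isMetricAt_metComp hg.smooth hφ hβ hy
  have hs : ∀ᶠ z in 𝓝 y, SmoothAt2 (metComp φ (g (T - η))) z := by
    filter_upwards [φ.open_target.mem_nhds hy] with z hz
    exact (isMetricAt_metComp hg.smooth hφ hβ hz).smooth
  have hRic := hg.ricci_symm hT hφ hβ hy
  rw [sum_pd_flux hG hs hRic (hH.smooth.smoothAt2 hφ hη hy) (hh.smooth.smoothAt2 hφ hβ hy)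
    (conComp_transpose (hH.symm η hη) y) (covComp_transpose (hh.symm _ hβ) y)]
  set G := metComp φ (g (T - η)) with hGdef
  -- Time reversal turns `-2 Ric` into `2 Ric`; its trace `2 R` (`hR` below) combines with the `1 /
  -- 2` of the square root to give `R √g`.
  have d1 := hasDerivWithinAt_sqrt_det (A := fun τ => metComp φ (g (T - τ)) y)
    (A' := (2 : ℝ) • Matrix.of (ricci G y)) (s := Icc 0 T) (t := η) hG.det_pos fun a b => by
      have h1 := hasDerivWithinAt_comp_const_sub (hg.flow φ hφ _ hβ y hy a b)
      simpa using h1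
  have d2 := hasDerivWithinAt_dot2 (A := fun τ => conComp φ (H τ) y)
    (A' := Matrix.of (lichCon G (conComp φ (H η)) y) - scalarCurv G y • conComp φ (H η) y)
    (B := fun τ => covComp φ (h (T - τ)) y)
    (B' := -Matrix.of (lichCov G (covComp φ (h (T - η))) y))
    (s := Icc 0 T) (t := η) (fun a b => hH.flow φ hφ η hη y hy a b)
    (fun a b => hasDerivWithinAt_comp_const_sub (hh.flow φ hφ _ hβ y hy a b))
  refine (d1.mul d2).congr_deriv ?_
  have hR : ((G y)⁻¹ * ((2 : ℝ) • Matrix.of (ricci G y))).trace = 2 * scalarCurv G y := by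
    rw [Matrix.mul_smul, Matrix.trace_smul, smul_eq_mul]
    congr 1
    simp only [Matrix.trace, Matrix.diag_apply, Matrix.mul_apply, Matrix.of_apply, scalarCurv]
    exact Finset.sum_congr rfl fun a _ => Finset.sum_congr rfl fun b _ => by rw [hRic b a]; rfl
  have hneg : dot2 (conComp φ (H η) y) (-Matrix.of (lichCov G (covComp φ (h (T - η))) y)) =
      -dot2 (conComp φ (H η) y) (Matrix.of (lichCov G (covComp φ (h (T - η))) y)) := by
    rw [← neg_one_smul ℝ, dot2_smul_right, neg_one_mul]
  rw [← hGdef, hR, hneg, dot2_sub_left, dot2_smul_left]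
  ring

theorem contDiffOn_pairingDensity (hg : IsRicciFlow g T)
    (hH : IsConjugateLinearizedFlow (fun η => g (T - η)) H T)
    (hh : IsReducedLinearizedFlow g h T) {φ : OpenPartialHomeomorph M (Coord n)}
    (hφ : φ ∈ atlas (Coord n) M) :
    ContDiffOn ℝ ∞ (fun p : ℝ × Coord n => pairingDensity g H h T φ p.1 p.2)
      (Icc 0 T ×ˢ φ.target) := by
  have hrev : ContDiffOn ℝ ∞ (fun p : ℝ × Coord n => (T - p.1, p.2)) (Icc 0 T ×ˢ φ.target) :=
    ((contDiff_const.sub contDiff_fst).prodMk contDiff_snd).contDiffOn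
  have hmaps : MapsTo (fun p : ℝ × Coord n => (T - p.1, p.2)) (Icc 0 T ×ˢ φ.target)
      (Icc 0 T ×ˢ φ.target) := fun p hp => ⟨const_sub_mem_Icc hp.1, hp.2⟩
  have hGs : ∀ a b, ContDiffOn ℝ ∞ (fun p : ℝ × Coord n => metComp φ (g (T - p.1)) p.2 a b)
      (Icc 0 T ×ˢ φ.target) := fun a b => (hg.smooth φ hφ a b).comp hrev hmaps
  have hhs : ∀ a b, ContDiffOn ℝ ∞ (fun p : ℝ × Coord n => covComp φ (h (T - p.1)) p.2 a b)
      (Icc 0 T ×ˢ φ.target) := fun a b => (hh.smooth φ hφ a b).comp hrev hmaps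
  have hdet : ContDiffOn ℝ ∞ (fun p : ℝ × Coord n => (metComp φ (g (T - p.1)) p.2).det)
      (Icc 0 T ×ˢ φ.target) := by
    simp only [Matrix.det_apply']
    exact ContDiffOn.sum fun σ _ => contDiffOn_const.mul (contDiffOn_prod fun j _ => hGs _ _)
  refine (hdet.sqrt fun p hp => (metComp_det_pos hφ _ hp.2).ne').mul ?_
  exact ContDiffOn.sum fun a _ => ContDiffOn.sum fun b _ => (hH.smooth φ hφ a b).mul (hhs a b)

variable [T2Space M] [CompactSpace M] [MeasurableSpace M] [BorelSpace M]

/-- After this rewriting the charts, the domains and the cutoffs are independent of `η`; only the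
density depends on time. -/
theorem integral_pairing_eq (hg : IsRicciFlow g T)
    (hH : IsConjugateLinearizedFlow (fun η => g (T - η)) H T)
    (hh : IsReducedLinearizedFlow g h T) {η : ℝ} (hη : η ∈ Icc 0 T) :
    ∫ x, pairing (H η) (h (T - η)) x ∂(riemannianMeasure (g (T - η))) =
      ∑ p ∈ chartIndex n M, ∫ y in (chartAt (Coord n) p).target,
        cutoff n M p p y * pairingDensity g H h T (chartAt (Coord n) p) η y := by
  have hβ := const_sub_mem_Icc hη
  rw [integral_riemannianMeasure
    (fun φ hφ y hy => isMetricAt_metComp hg.smooth hφ hβ hy)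
    (continuous_pairing (fun φ hφ y hy => hH.smooth.smoothAt2 hφ hη hy)
      fun φ hφ y hy => hh.smooth.smoothAt2 hφ hβ hy)]
  refine Finset.sum_congr rfl fun p _ => ?_
  refine setIntegral_congr_fun (chartAt (Coord n) p).open_target.measurableSet fun y hy => ?_
  simp only [pairing_symm_eq (chart_mem_atlas _ p) _ _ hy, pairingDensity]

theorem hasDerivWithinAt_integral_pairing (hT : 0 < T) (hg : IsRicciFlow g T)
    (hH : IsConjugateLinearizedFlow (fun η => g (T - η)) H T)
    (hh : IsReducedLinearizedFlow g h T) {η : ℝ} (hη : η ∈ Icc 0 T) :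
    HasDerivWithinAt
      (fun τ => ∫ x, pairing (H τ) (h (T - τ)) x ∂(riemannianMeasure (g (T - τ)))) 0
      (Icc 0 T) η := by
  refine HasDerivWithinAt.congr ?_ (fun τ hτ => integral_pairing_eq hg hH hh hτ)
    (integral_pairing_eq hg hH hh hη)
  have hβ := const_sub_mem_Icc hη
  -- The value `0` is replaced by the vanishing sum of chart integrals of the divergence, so that
  -- the derivative can be matched chart by chart.
  refine HasDerivWithinAt.congr_deriv ?_ (sum_setIntegral_cutoff_mul_divergence (g := g (T - η)) (H := H η) (h := h (T - η))
    (fun φ hφ y hy => isMetricAt_metComp hg.smooth hφ hβ hy)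
    (fun φ hφ y hy => hH.smooth.smoothAt2 hφ hη hy)
    fun φ hφ y hy => hh.smooth.smoothAt2 hφ hβ hy)
  refine HasDerivWithinAt.fun_sum fun p _ => ?_
  have hφ := chart_mem_atlas (Coord n) p
  exact hasDerivWithinAt_setIntegral hT
    (f := fun τ y => cutoff n M p p y * pairingDensity g H h T (chartAt (Coord n) p) τ y)
    (f' := fun τ y => cutoff n M p p y * ∑ k, pd k (chartFlux (g (T - τ)) (H τ) (h (T - τ)) p k) y)
    (chartAt (Coord n) p).open_target (isCompact_cutoffSupport p) (cutoffSupport_subset p)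
    (ContDiffOn.mul (fun q hq => ((contDiffAt_cutoff p hq.2).comp q
      contDiffAt_snd).contDiffWithinAt) (contDiffOn_pairingDensity hg hH hh hφ))
    (fun τ hτ y hy => (hasDerivWithinAt_pairingDensity hT hg hH hh hφ hτ hy).const_mul _)
    (fun τ _ y hy => by rw [cutoff_eq_zero hy, zero_mul])
    (fun τ _ y hy => by rw [cutoff_eq_zero hy, zero_mul]) hη

end Flow

end ConjRicci

end

theorem proposition3p5 {n : ℕ} {M : Type*} [TopologicalSpace M] [T2Space M] [CompactSpace M]
    [ChartedSpace (EuclideanSpace ℝ (Fin n)) M] [IsManifold (𝓡 n) ∞ M]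
    [MeasurableSpace M] [BorelSpace M]
    (T : ℝ) (hT : 0 ≤ T)
    (g : ℝ → ConjRicci.Metric n M) (hg : ConjRicci.IsRicciFlow g T)
    (H : ℝ → ConjRicci.ConTensor n M)
    (hH : ConjRicci.IsConjugateLinearizedFlow (fun η => g (T - η)) H T)
    (h : ℝ → ConjRicci.CovTensor n M) (hh : ConjRicci.IsReducedLinearizedFlow g h T) :
    (∀ η ∈ Icc 0 T, HasDerivWithinAt
      (fun η' => ∫ x, ConjRicci.pairing (H η') (h (T - η')) x
        ∂(ConjRicci.riemannianMeasure (g (T - η')))) 0 (Icc 0 T) η) ∧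
    ∫ x, ConjRicci.pairing (H 0) (h T) x ∂(ConjRicci.riemannianMeasure (g T)) =
      ∫ x, ConjRicci.pairing (H T) (h 0) x ∂(ConjRicci.riemannianMeasure (g 0)) := by
  -- For `T = 0` the interval is a point: any value is a derivative within it, and both integrals
  -- are the same.
  rcases hT.eq_or_lt with rfl | hT0
  · refine ⟨fun η hη => ?_, rfl⟩
    rw [Icc_self]
    exact (HasFDerivWithinAt.of_subsingleton subsingleton_singleton)
  · have hd := fun η (hη : η ∈ Icc 0 T) =>
      ConjRicci.hasDerivWithinAt_integral_pairing hT0 hg hH hh hη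
    refine ⟨hd, ?_⟩
    -- A function on `[0, T]` is constant once its derivative within the interval vanishes on `[0,
    -- T)`.
    have h1 := constant_of_derivWithin_zero
      (fun η hη => (hd η hη).differentiableWithinAt)
      (fun η hη => (hd η ⟨hη.1, hη.2.le⟩).derivWithin
        (uniqueDiffOn_Icc hT0 η ⟨hη.1, hη.2.le⟩)) T (right_mem_Icc.mpr hT)
    simp only [sub_self, sub_zero] at h1
    exact h1.symm
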